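/- All manifolds are smooth ($C^\infty$) real Banach manifolds. An $\mathcal N$-operator on a manifold $M$ is a smooth vector bundle morphism $N:\mathsf TM\to\mathsf TM$ covering $\mathrm{id}_M$ and bounded linear on the fibres; its Nijenhuis torsion is $\mathcal T_N(X,Y)=[NX,NY]-N\big([NX,Y]+[X,NY]-N[X,Y]\big)$ for local smooth vector fields $X,Y$. A complex structure is an $\mathcal N$-operator with $N^2=-\mathrm{id}$ and $\mathcal T_N=0$. If $\tau:M\to M_0$ is a smooth surjective submersion (all tangent maps surjective; their kernels need not be complemented), then $N$ projects onto an $\mathcal N$-operator $N_0$ on $M_0$ if $N_0\circ\mathsf T\tau=\mathsf T\tau\circ N$, and $N$ is projectable if it projects onto some $\mathcal N$-operator on $M_0$. **Theorem.** Let $G$ be a real Banach–Lie group with Lie algebra $\mathfrak g=\mathsf T_eG$. Let $K\subset G$ be an embedded Banach–Lie subgroup (a Banach–Lie group in the subspace topology whose inclusion into $G$ is smooth with injective tangent maps of closed range), with $\mathfrak k=\mathsf T_eK\subset\mathfrak g$. Suppose that $G/K$ is a Banach manifold, with the quotient topology, such that the projection $\tau:G\to G/K$ is a smooth submersion. Let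 $N$ be an $\mathcal N$-operator on $G$ which is left-invariant, i.e. $N_g(\mathsf T_eL_gX)=\mathsf T_eL_g(N_eX)$ for all $g\in G$, $X\in\mathfrak g$, where $L_g$ is the left translation by $g$, and projectable along $\tau$. Put $\mathcal T_{N_e}(X,Y)=[N_eX,N_eY]-N_e\big([N_eX,Y]+[X,N_eY]-N_e[X,Y]\big)$ for $X,Y\in\mathfrak g$. 1. $N$ projects onto a complex structure $N_0$ on $G/K$ if and only if $$(N_e^2+\mathrm{id})(X)\in\mathfrak k\quad\text{and}\quad \mathcal T_{N_e}(X,Y)\in\mathfrak k\qquad\text{for all }X,Y\in\mathfrak g.\tag{$*$}$$ 2. Condition $(*)$ holds if and only if $\mathcal Z_+=\{X+iY\in\mathfrak g^{\mathbb C}: X,Y\in\mathfrak g,\ Y-N_eX\in\mathfrak k\}$ is a complex Lie subalgebra of $\mathfrak g^{\mathbb C}=\mathbb C\otimes_{\mathbb R}\mathfrak g$. 3. Condition $(*)$ holds if and only if $\mathcal Z_-=\{X+iY\in\mathfrak g^{\mathbb C}: X,Y\in\mathfrak g,\ Y+N_eX\in\mathfrak k\}$ is a complex Lie subalgebra of $\mathfrak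 g^{\mathbb C}$. -/

import Mathlib

open scoped Manifold ContDiff TensorProduct

noncomputable section

/-- For a smooth real Lie group, Mathlib's Lie algebra structure on the tangent space at the
identity asks for the regularity `minSmoothness ℝ 3 = 3`, which is below `∞`. -/
instance instLEInftyMinSmoothnessRealThree : ENat.LEInfty (minSmoothness ℝ 3) :=
  ⟨by rw [minSmoothness_of_isRCLikeNormedField]; exact ENat.LEInfty.out⟩

section Manifolds

/-- An `𝒩`-operator on a smooth Banach manifold `M` modelled on `E`: a morphism `TM → TM` of vector
bundles covering the identity, i.e. a family of bounded operators of the tangent spaces which is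
smooth as a map of the total space `TM`. -/
structure NOperator (E : Type*) [NormedAddCommGroup E] [NormedSpace ℝ E]
    (M : Type*) [TopologicalSpace M] [ChartedSpace E M] [IsManifold 𝓘(ℝ, E) ∞ M] where
  /-- The bounded operator in the fibre over `x`. -/
  op : ∀ x : M, TangentSpace 𝓘(ℝ, E) x →L[ℝ] TangentSpace 𝓘(ℝ, E) x
  smooth_op : ContMDiff (𝓘(ℝ, E).tangent) (𝓘(ℝ, E).tangent) ∞
    (fun v : TangentBundle 𝓘(ℝ, E) M => (⟨v.1, op v.1 v.2⟩ : TangentBundle 𝓘(ℝ, E) M))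

variable {E : Type*} [NormedAddCommGroup E] [NormedSpace ℝ E]
  {M : Type*} [TopologicalSpace M] [ChartedSpace E M] [IsManifold 𝓘(ℝ, E) ∞ M]
  {E₀ : Type*} [NormedAddCommGroup E₀] [NormedSpace ℝ E₀]
  {M₀ : Type*} [TopologicalSpace M₀] [ChartedSpace E₀ M₀] [IsManifold 𝓘(ℝ, E₀) ∞ M₀]

namespace NOperator

/-- The image `NX` of a vector field `X`. -/
def onField (N : NOperator E M) (X : ∀ x : M, TangentSpace 𝓘(ℝ, E) x) (x : M) :
    TangentSpace 𝓘(ℝ, E) x :=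
  N.op x (X x)

/-- The Nijenhuis torsion `[NX, NY] - N([NX, Y] + [X, NY] - N[X, Y])` at the point `x`. -/
def torsion (N : NOperator E M) (X Y : ∀ x : M, TangentSpace 𝓘(ℝ, E) x) (x : M) :
    TangentSpace 𝓘(ℝ, E) x :=
  VectorField.mlieBracket 𝓘(ℝ, E) (N.onField X) (N.onField Y) x
    - N.op x (VectorField.mlieBracket 𝓘(ℝ, E) (N.onField X) Y x
        + VectorField.mlieBracket 𝓘(ℝ, E) X (N.onField Y) x
        - N.op x (VectorField.mlieBracket 𝓘(ℝ, E) X Y x))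

/-- `N` is a Nijenhuis operator: its torsion vanishes on all smooth vector fields defined locally
(on an open set `U`; the values of `X` and `Y` outside `U` play no role). -/
def IsNijenhuis (N : NOperator E M) : Prop :=
  ∀ (U : Set M), IsOpen U → ∀ X Y : (∀ x : M, TangentSpace 𝓘(ℝ, E) x),
    ContMDiffOn 𝓘(ℝ, E) (𝓘(ℝ, E).tangent) ∞
      (fun x => (⟨x, X x⟩ : TangentBundle 𝓘(ℝ, E) M)) U →
    ContMDiffOn 𝓘(ℝ, E) (𝓘(ℝ, E).tangent) ∞
      (fun x => (⟨x, Y x⟩ : TangentBundle 𝓘(ℝ, E) M)) U →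
    ∀ x ∈ U, N.torsion X Y x = 0

/-- `N` is an almost complex structure: `N² = -id`. -/
def IsAlmostComplex (N : NOperator E M) : Prop :=
  ∀ (x : M) (v : TangentSpace 𝓘(ℝ, E) x), N.op x (N.op x v) = -v

/-- `N` is a complex structure: an almost complex structure with vanishing torsion. -/
def IsComplexStructure (N : NOperator E M) : Prop :=
  N.IsAlmostComplex ∧ N.IsNijenhuis

/-- `N` projects onto `N₀` along `τ : M → M₀`: `N₀ ∘ Tτ = Tτ ∘ N`. -/
def ProjectsOnto (τ : M → M₀) (N : NOperator E M) (N₀ : NOperator E₀ M₀) : Prop :=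
  ∀ (x : M) (v : TangentSpace 𝓘(ℝ, E) x),
    N₀.op (τ x) (mfderiv 𝓘(ℝ, E) 𝓘(ℝ, E₀) τ x v)
      = mfderiv 𝓘(ℝ, E) 𝓘(ℝ, E₀) τ x (N.op x v)

/-- `N` is projectable along `τ : M → M₀`: it projects onto some `𝒩`-operator on `M₀`. -/
def IsProjectable (E₀ : Type*) [NormedAddCommGroup E₀] [NormedSpace ℝ E₀]
    {M₀ : Type*} [TopologicalSpace M₀] [ChartedSpace E₀ M₀] [IsManifold 𝓘(ℝ, E₀) ∞ M₀]
    (τ : M → M₀) (N : NOperator E M) : Prop :=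
  ∃ N₀ : NOperator E₀ M₀, ProjectsOnto τ N N₀

end NOperator

/-- A Banach fibration: a smooth surjective submersion. The kernels of the tangent maps (which are
closed) are not required to have closed complements. -/
structure IsBanachFibration (E E₀ : Type*) [NormedAddCommGroup E] [NormedSpace ℝ E]
    [NormedAddCommGroup E₀] [NormedSpace ℝ E₀]
    {M : Type*} [TopologicalSpace M] [ChartedSpace E M]
    {M₀ : Type*} [TopologicalSpace M₀] [ChartedSpace E₀ M₀] (τ : M → M₀) : Prop where
  smooth : ContMDiff 𝓘(ℝ, E) 𝓘(ℝ, E₀) ∞ τ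
  surjective : Function.Surjective τ
  submersion : ∀ x : M, Function.Surjective (mfderiv 𝓘(ℝ, E) 𝓘(ℝ, E₀) τ x)

end Manifolds

section Groups

/-- A subgroup `K` of a Banach-Lie group `G`, carrying a manifold structure (modelled on `F`)
for its subspace topology, is embedded: the inclusion is smooth and its tangent maps are
injective with closed range. (The inclusion is a topological embedding by construction.) -/
structure IsEmbeddedBanachSubgroup (E F : Type*) [NormedAddCommGroup E] [NormedSpace ℝ E]
    [NormedAddCommGroup F] [NormedSpace ℝ F]
    {G : Type*} [TopologicalSpace G] [ChartedSpace E G] [Group G]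
    (K : Subgroup G) [ChartedSpace F K] : Prop where
  smooth : ContMDiff 𝓘(ℝ, F) 𝓘(ℝ, E) ∞ (fun k : K => (k : G))
  injective : ∀ k : K, Function.Injective
    (mfderiv 𝓘(ℝ, F) 𝓘(ℝ, E) (fun k : K => (k : G)) k)
  closed_range : ∀ k : K, IsClosed
    (Set.range (mfderiv 𝓘(ℝ, F) 𝓘(ℝ, E) (fun k : K => (k : G)) k))

/-- The subspace `𝔨 = T_e K` of `𝔤 = T_e G`: the image of the tangent map at `e` of `K → G`. -/
def subgroupLieAlgebra (E F : Type*) [NormedAddCommGroup E] [NormedSpace ℝ E]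
    [NormedAddCommGroup F] [NormedSpace ℝ F]
    {G : Type*} [TopologicalSpace G] [ChartedSpace E G] [Group G]
    (K : Subgroup G) [ChartedSpace F K] : Submodule ℝ (GroupLieAlgebra 𝓘(ℝ, E) G) :=
  LinearMap.range (show TangentSpace 𝓘(ℝ, F) (1 : K) →ₗ[ℝ] GroupLieAlgebra 𝓘(ℝ, E) G from
    (mfderiv 𝓘(ℝ, F) 𝓘(ℝ, E) (fun k : K => (k : G)) 1).toLinearMap)

variable {E : Type*} [NormedAddCommGroup E] [NormedSpace ℝ E]
  {G : Type*} [TopologicalSpace G] [ChartedSpace E G] [Group G] [LieGroup 𝓘(ℝ, E) ∞ G]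

/-- `N` is (left) invariant: `N_g(gX) = g N_e(X)` for all `g ∈ G` and `X ∈ 𝔤`, where `gX` is the
image of `X` under the tangent map at `e` of the left translation by `g`. -/
def NOperator.IsLeftInvariant (N : NOperator E G) : Prop :=
  ∀ (g : G) (X : GroupLieAlgebra 𝓘(ℝ, E) G),
    N.op g (mulInvariantVectorField X g) = mulInvariantVectorField (N.op 1 X) g

/-- The operator `N_e` on the Lie algebra `𝔤 = T_e G`. -/
def NOperator.atOne (N : NOperator E G) :
    GroupLieAlgebra 𝓘(ℝ, E) G →ₗ[ℝ] GroupLieAlgebra 𝓘(ℝ, E) G :=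
  (N.op 1 : GroupLieAlgebra 𝓘(ℝ, E) G →ₗ[ℝ] GroupLieAlgebra 𝓘(ℝ, E) G)

end Groups

section LieAlgebras

variable {L : Type*} [LieRing L] [LieAlgebra ℝ L]

/-- The Nijenhuis torsion of a linear operator on a Lie algebra. -/
def lieTorsion (N : L →ₗ[ℝ] L) (X Y : L) : L :=
  ⁅N X, N Y⁆ - N (⁅N X, Y⁆ + ⁅X, N Y⁆ - N ⁅X, Y⁆)

/-- `𝒵₊ = {X + iY ∈ L^ℂ : Y - NX ∈ 𝔨}` in the complexification `L^ℂ = ℂ ⊗ L`. -/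
def zPlus (N : L →ₗ[ℝ] L) (𝔨 : Submodule ℝ L) : Set (ℂ ⊗[ℝ] L) :=
  {z | ∃ X Y : L, z = (1 : ℂ) ⊗ₜ[ℝ] X + Complex.I ⊗ₜ[ℝ] Y ∧ Y - N X ∈ 𝔨}

/-- `𝒵₋ = {X + iY ∈ L^ℂ : Y + NX ∈ 𝔨}` in the complexification `L^ℂ = ℂ ⊗ L`. -/
def zMinus (N : L →ₗ[ℝ] L) (𝔨 : Submodule ℝ L) : Set (ℂ ⊗[ℝ] L) :=
  {z | ∃ X Y : L, z = (1 : ℂ) ⊗ₜ[ℝ] X + Complex.I ⊗ₜ[ℝ] Y ∧ Y + N X ∈ 𝔨}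

/-- A subset of the complexification is a complex Lie subalgebra. -/
def IsComplexLieSubalgebra (Z : Set (ℂ ⊗[ℝ] L)) : Prop :=
  ∃ S : LieSubalgebra ℂ (ℂ ⊗[ℝ] L), (S : Set (ℂ ⊗[ℝ] L)) = Z

end LieAlgebras

end

/-! ### Linear algebra of `𝒵₊` and `𝒵₋` in the complexification -/

section ComplexSubalgebras

variable {L : Type*} [LieRing L] [LieAlgebra ℝ L]

/-! The proof rests on two facts: `𝔨` is the kernel of the tangent map of `τ` at `e`, and the
torsion, being a tensor, can be pushed forward by `Tτ`.

The kernels of `Tτ` need not be complemented, so no local sections or smooth lifts of vector fields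
are at hand, and left-invariant fields are in general not `τ`-related to fields on `G/K`. Instead
one uses `Df[V,W] = D(Df·W)V - D(Df·V)W`, valid for any `C²` map `f`, which needs no field
downstairs. If `N` projects onto `N₀`, this formula shows that `Tτ` carries the torsion of `N` to
the torsion tensor of `N₀` at the projected values (`tangentCoord_mfderiv_torsion`). Every tangent
vector of `G` is a value of a left-invariant field, and the torsion of two such fields is the
left-invariant field of the torsion on `𝔤`. Hence `N₀` is torsion-free iff the torsion of `N_e` lies
in `𝔨`, and likewise `N₀² = -id` iff `N_e² + id` has values in `𝔨`. Applied to vertical fields, the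
same formula gives `[𝔨,𝔨] ⊆ 𝔨` and `[k, N_e X] - N_e[k,X] ∈ 𝔨`.

That `ker T_eτ ⊆ 𝔨` (`mem_subgroupLieAlgebra_iff`) is the analytic point: a kernel vector is the
velocity of a curve in the fibre `K` (open mapping with estimates), and such a velocity is tangent
to `K` since the inclusion is an immersion with closed range.

The rest is algebra (`isComplexLieSubalgebra_zPlus_iff`). `𝒵₊` is the graph of `N_e` modulo `𝔨`:
stability under `i` amounts to the condition on `N_e²`, and then stability under brackets to the
condition on the torsion. Finally `𝒵₋` is `𝒵₊` for `-N_e`, and `(*)` is even in `N_e`. -/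

theorem realTensor_eq_iff {X Y X' Y' : L} :
    (1 : ℂ) ⊗ₜ[ℝ] X + Complex.I ⊗ₜ[ℝ] Y = (1 : ℂ) ⊗ₜ[ℝ] X' + Complex.I ⊗ₜ[ℝ] Y' ↔
      X = X' ∧ Y = Y' := by
  refine ⟨fun h => ⟨?_, ?_⟩, fun h => by rw [h.1, h.2]⟩
  · simpa using congrArg (fun z => TensorProduct.lid ℝ L (Complex.reLm.rTensor L z)) h
  · simpa using congrArg (fun z => TensorProduct.lid ℝ L (Complex.imLm.rTensor L z)) h

theorem mem_zPlus_iff {N : L →ₗ[ℝ] L} {𝔨 : Submodule ℝ L} {X Y : L} :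
    (1 : ℂ) ⊗ₜ[ℝ] X + Complex.I ⊗ₜ[ℝ] Y ∈ zPlus N 𝔨 ↔ Y - N X ∈ 𝔨 := by
  constructor
  · rintro ⟨X', Y', h, hk⟩
    obtain ⟨rfl, rfl⟩ := realTensor_eq_iff.1 h
    exact hk
  · exact fun h => ⟨X, Y, rfl, h⟩

theorem lie_realTensor (X Y X' Y' : L) :
    ⁅(1 : ℂ) ⊗ₜ[ℝ] X + Complex.I ⊗ₜ[ℝ] Y, (1 : ℂ) ⊗ₜ[ℝ] X' + Complex.I ⊗ₜ[ℝ] Y'⁆ =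
      (1 : ℂ) ⊗ₜ[ℝ] (⁅X, X'⁆ - ⁅Y, Y'⁆) + Complex.I ⊗ₜ[ℝ] (⁅X, Y'⁆ + ⁅Y, X'⁆) := by
  simp only [add_lie, lie_add, LieAlgebra.ExtendScalars.bracket_tmul, mul_one, one_mul,
    Complex.I_mul_I, TensorProduct.neg_tmul, TensorProduct.tmul_sub, TensorProduct.tmul_add]
  abel

theorem smul_realTensor (c : ℂ) (X Y : L) :
    c • ((1 : ℂ) ⊗ₜ[ℝ] X + Complex.I ⊗ₜ[ℝ] Y) =
      (1 : ℂ) ⊗ₜ[ℝ] (c.re • X - c.im • Y) + Complex.I ⊗ₜ[ℝ] (c.re • Y + c.im • X) := by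
  obtain ⟨a, b⟩ := c
  have h1 : (⟨a, b⟩ : ℂ) = a • (1 : ℂ) + b • Complex.I := by
    apply Complex.ext <;> simp
  have h2 : (⟨a, b⟩ : ℂ) * Complex.I = a • Complex.I - b • (1 : ℂ) := by
    apply Complex.ext <;> simp
  change _ = (1 : ℂ) ⊗ₜ[ℝ] (a • X - b • Y) + Complex.I ⊗ₜ[ℝ] (a • Y + b • X)
  rw [smul_add, TensorProduct.smul_tmul', TensorProduct.smul_tmul', smul_eq_mul, smul_eq_mul,
    mul_one, h2, h1]
  simp only [TensorProduct.add_tmul, TensorProduct.sub_tmul, TensorProduct.smul_tmul,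
    TensorProduct.tmul_sub, TensorProduct.tmul_add]
  abel

theorem lieTorsion_neg (N : L →ₗ[ℝ] L) (X Y : L) : lieTorsion (-N) X Y = lieTorsion N X Y := by
  simp only [lieTorsion, LinearMap.neg_apply, neg_lie, lie_neg, map_add, map_neg, map_sub]
  abel

theorem zPlus_neg (N : L →ₗ[ℝ] L) (𝔨 : Submodule ℝ L) : zPlus (-N) 𝔨 = zMinus N 𝔨 := by
  simp [zPlus, zMinus]

/-- If `N` preserves the subalgebra `𝔨` and commutes with `ad 𝔨` modulo `𝔨`, then `N` induces a
complex structure modulo `𝔨` if and only if `𝒵₊` is a complex Lie subalgebra. -/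
theorem isComplexLieSubalgebra_zPlus_iff (N : L →ₗ[ℝ] L) (𝔨 : Submodule ℝ L)
    (hN : ∀ k ∈ 𝔨, N k ∈ 𝔨) (hlie : ∀ k ∈ 𝔨, ∀ l ∈ 𝔨, ⁅k, l⁆ ∈ 𝔨)
    (hcomm : ∀ k ∈ 𝔨, ∀ X, ⁅k, N X⁆ - N ⁅k, X⁆ ∈ 𝔨) :
    ((∀ X, N (N X) + X ∈ 𝔨) ∧ ∀ X Y, lieTorsion N X Y ∈ 𝔨) ↔
      IsComplexLieSubalgebra (zPlus N 𝔨) := by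
  constructor
  · rintro ⟨hsq, htor⟩
    -- Apply `N` to `[k, NX] - N[k,X] ∈ 𝔨` and replace `N²` by `-id` modulo `𝔨`.
    have hvert : ∀ k ∈ 𝔨, ∀ X, ⁅k, X⁆ + N ⁅k, N X⁆ ∈ 𝔨 := by
      intro k hk X
      have := 𝔨.add_mem (hN _ (hcomm k hk X)) (hsq ⁅k, X⁆)
      rw [map_sub] at this
      convert this using 1
      abel
    refine ⟨⟨⟨⟨⟨zPlus N 𝔨, ?_⟩, ?_⟩, ?_⟩, ?_⟩, rfl⟩
    · rintro _ _ ⟨X, Y, rfl, h⟩ ⟨X', Y', rfl, h'⟩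
      refine ⟨X + X', Y + Y', ?_, ?_⟩
      · simp only [TensorProduct.tmul_add]; abel
      · rw [map_add, add_sub_add_comm]; exact 𝔨.add_mem h h'
    · exact ⟨0, 0, by simp, by simp⟩
    · rintro c _ ⟨X, Y, rfl, h⟩
      rw [smul_realTensor, mem_zPlus_iff]
      have h1 := 𝔨.smul_mem c.re h
      have h2 := 𝔨.smul_mem c.im (𝔨.add_mem (hN _ h) (hsq X))
      convert 𝔨.add_mem h1 h2 using 1
      simp only [map_sub, map_smul, smul_sub, smul_add]
      abel
    · rintro _ _ ⟨X, Y, rfl, h⟩ ⟨X', Y', rfl, h'⟩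
      change _ ∈ zPlus N 𝔨
      rw [lie_realTensor, mem_zPlus_iff]
      obtain ⟨k, hk, rfl⟩ : ∃ k ∈ 𝔨, Y = N X + k := ⟨_, h, by abel⟩
      obtain ⟨k', hk', rfl⟩ : ∃ k' ∈ 𝔨, Y' = N X' + k' := ⟨_, h', by abel⟩
      -- The defect of the bracket splits by degree in `k, k'`. The part without them is `N T(X,X')
      -- + (N² + id)Z` with `Z = [NX,X'] + [X,NX'] - N[X,X']`; the linear part is `h2`, the bilinear
      -- part `N[k,k']`.
      have h1 := 𝔨.add_mem (hN _ (htor X X')) (hsq (⁅N X, X'⁆ + ⁅X, N X'⁆ - N ⁅X, X'⁆))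
      have h2 := 𝔨.sub_mem (hvert k hk X') (hvert k' hk' X)
      have h3 := hN _ (hlie k hk k' hk')
      convert 𝔨.add_mem (𝔨.add_mem h1 h2) h3 using 1
      simp only [lieTorsion, map_sub, map_add, add_lie, lie_add]
      rw [← lie_skew X k', ← lie_skew (N X) k']
      simp only [map_neg]
      abel
  · rintro ⟨S, hS⟩
    have hmem : ∀ X, (1 : ℂ) ⊗ₜ[ℝ] X + Complex.I ⊗ₜ[ℝ] N X ∈ S := fun X => by
      rw [← SetLike.mem_coe, hS, mem_zPlus_iff]; simp
    have hsq : ∀ X, N (N X) + X ∈ 𝔨 := by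
      intro X
      have := S.smul_mem Complex.I (hmem X)
      rw [← SetLike.mem_coe, hS, smul_realTensor, mem_zPlus_iff] at this
      simpa [add_comm] using this
    refine ⟨hsq, fun X Y => ?_⟩
    have := S.lie_mem (hmem X) (hmem Y)
    rw [← SetLike.mem_coe, hS, lie_realTensor, mem_zPlus_iff] at this
    -- With `W` the defect of the bracket of `X + iNX` and `Y + iNY`, the torsion is `(N² +
    -- id)[NX,NY] - NW`.
    convert 𝔨.sub_mem (hsq ⁅N X, N Y⁆) (hN _ this) using 1
    simp only [lieTorsion, map_sub, map_add]
    abel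

end ComplexSubalgebras

/-! ### Calculus in Banach spaces: pushing brackets forward, curves in fibres -/

section Flat

open Filter Topology Asymptotics VectorField

variable {E : Type*} [NormedAddCommGroup E] [NormedSpace ℝ E]
  {F : Type*} [NormedAddCommGroup F] [NormedSpace ℝ F]
  {B : Type*} [NormedAddCommGroup B] [NormedSpace ℝ B]

/-- The Nijenhuis torsion at `z`, evaluated on `a` and `b`, of the fibrewise linear map
`(z, b) ↦ n (z, b)` of the tangent bundle of a normed space. -/
noncomputable def torsionTensor (n : B × B → B) (z a b : B) : B :=
  fderiv ℝ n (z, b) (n (z, a), 0) - fderiv ℝ n (z, a) (n (z, b), 0)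
    - (n (z, fderiv ℝ n (z, b) (a, 0)) - n (z, fderiv ℝ n (z, a) (b, 0)))

/-- A differentiable, fibrewise linear map differentiated along a curve of vectors. -/
theorem fderiv_comp_fibrewise_linear {n : B × B → B} {f : E → B} {a : E → B} {x v : E}
    {ℓ : B →L[ℝ] B} (hn : DifferentiableAt ℝ n (f x, a x)) (hl : ∀ b, n (f x, b) = ℓ b)
    (hf : DifferentiableAt ℝ f x) (ha : DifferentiableAt ℝ a x) :
    fderiv ℝ (fun y => n (f y, a y)) x v =
      fderiv ℝ n (f x, a x) (fderiv ℝ f x v, 0) + n (f x, fderiv ℝ a x v) := by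
  have h1 : HasFDerivAt (fun y => n (f y, a y))
      ((fderiv ℝ n (f x, a x)).comp ((fderiv ℝ f x).prod (fderiv ℝ a x))) x :=
    hn.hasFDerivAt.comp x (hf.hasFDerivAt.prodMk ha.hasFDerivAt)
  -- In the fibre direction `n` is linear, hence its own derivative. Only joint differentiability of
  -- `n` is used, not that of the operator-valued map `z ↦ n (z, ·)`.
  have h2 : ∀ w, fderiv ℝ n (f x, a x) (0, w) = ℓ w := by
    intro w
    have h3 : HasFDerivAt (fun b : B => n (f x, b))
        ((fderiv ℝ n (f x, a x)).comp (ContinuousLinearMap.inr ℝ B B)) (a x) :=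
      hn.hasFDerivAt.comp (a x) (hasFDerivAt_prodMk_right (f x) (a x))
    have h4 : HasFDerivAt (fun b : B => n (f x, b)) ℓ (a x) := by
      simp_rw [hl]; exact ℓ.hasFDerivAt
    simpa using DFunLike.congr_fun (h3.unique h4) w
  rw [h1.fderiv, hl, ← h2, ← map_add]
  simp

/-- The second derivative of `f` is symmetric and drops out of the difference. This form pushes a
bracket forward without a field on the target. -/
theorem fderiv_apply_lieBracket_two {f : E → B} {V W : E → E} {x : E} (hf : ContDiffAt ℝ 2 f x)
    (hV : DifferentiableAt ℝ V x) (hW : DifferentiableAt ℝ W x) :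
    fderiv ℝ f x (lieBracket ℝ V W x) =
      fderiv ℝ (fun y => fderiv ℝ f y (W y)) x (V x) -
        fderiv ℝ (fun y => fderiv ℝ f y (V y)) x (W x) :=
  fderiv_apply_lieBracket hf (by rw [minSmoothness_of_isRCLikeNormedField]) hW hV

theorem differentiableAt_fderiv_apply {f : E → B} {V : E → E} {x : E} (hf : ContDiffAt ℝ 2 f x)
    (hV : DifferentiableAt ℝ V x) : DifferentiableAt ℝ (fun y => fderiv ℝ f y (V y)) x :=
  ((hf.fderiv_right (m := 1) (by norm_num)).differentiableAt one_ne_zero).clm_apply hV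

/-- The torsion of vector fields `V`, `W` with images `P = NV`, `Q = NW` is mapped by a
differential intertwining `N` and `n` to the torsion tensor of `n`. -/
theorem fderiv_apply_torsion {n : B × B → B} {f : E → B} {V W P Q : E → E} {x : E} {ℓ : B →L[ℝ] B}
    (hf : ContDiffAt ℝ 2 f x) (hV : DifferentiableAt ℝ V x) (hW : DifferentiableAt ℝ W x)
    (hP : DifferentiableAt ℝ P x) (hQ : DifferentiableAt ℝ Q x)
    (hn : ∀ b, DifferentiableAt ℝ n (f x, b)) (hl : ∀ b, n (f x, b) = ℓ b)
    (hVP : ∀ᶠ y in 𝓝 x, fderiv ℝ f y (P y) = n (f y, fderiv ℝ f y (V y)))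
    (hWQ : ∀ᶠ y in 𝓝 x, fderiv ℝ f y (Q y) = n (f y, fderiv ℝ f y (W y))) :
    fderiv ℝ f x (lieBracket ℝ P Q x)
      - n (f x, fderiv ℝ f x (lieBracket ℝ P W x) + fderiv ℝ f x (lieBracket ℝ V Q x)
        - n (f x, fderiv ℝ f x (lieBracket ℝ V W x)))
      = torsionTensor n (f x) (fderiv ℝ f x (V x)) (fderiv ℝ f x (W x)) := by
  have hd := hf.differentiableAt two_ne_zero
  have hP' : ∀ v, fderiv ℝ (fun y => fderiv ℝ f y (P y)) x v =
      fderiv ℝ n (f x, fderiv ℝ f x (V x)) (fderiv ℝ f x v, 0)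
        + n (f x, fderiv ℝ (fun y => fderiv ℝ f y (V y)) x v) := fun v => by
    rw [EventuallyEq.fderiv_eq hVP]
    exact fderiv_comp_fibrewise_linear (hn _) hl hd (differentiableAt_fderiv_apply hf hV)
  have hQ' : ∀ v, fderiv ℝ (fun y => fderiv ℝ f y (Q y)) x v =
      fderiv ℝ n (f x, fderiv ℝ f x (W x)) (fderiv ℝ f x v, 0)
        + n (f x, fderiv ℝ (fun y => fderiv ℝ f y (W y)) x v) := fun v => by
    rw [EventuallyEq.fderiv_eq hWQ]
    exact fderiv_comp_fibrewise_linear (hn _) hl hd (differentiableAt_fderiv_apply hf hW)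
  rw [fderiv_apply_lieBracket_two hf hP hQ, fderiv_apply_lieBracket_two hf hP hW,
    fderiv_apply_lieBracket_two hf hV hQ, fderiv_apply_lieBracket_two hf hV hW]
  -- The derivatives of `y ↦ Df(V y)` and `y ↦ Df(W y)` cancel in pairs; the surviving terms depend
  -- only on values at `x`.
  simp only [hP', hQ', hVP.self_of_nhds, hWQ.self_of_nhds, torsionTensor]
  simp only [hl, map_add, map_sub]
  abel

/-- Brackets with a field tangent to the fibres commute with `N` modulo the fibres. -/
theorem fderiv_apply_lieBracket_vertical {n : B × B → B} {f : E → B} {V W Q : E → E} {x : E}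
    {ℓ : B →L[ℝ] B}
    (hf : ContDiffAt ℝ 2 f x) (hV : DifferentiableAt ℝ V x) (hW : DifferentiableAt ℝ W x)
    (hQ : DifferentiableAt ℝ Q x)
    (hn : ∀ b, DifferentiableAt ℝ n (f x, b)) (hl : ∀ b, n (f x, b) = ℓ b)
    (hV0 : ∀ᶠ y in 𝓝 x, fderiv ℝ f y (V y) = 0)
    (hWQ : ∀ᶠ y in 𝓝 x, fderiv ℝ f y (Q y) = n (f y, fderiv ℝ f y (W y))) :
    fderiv ℝ f x (lieBracket ℝ V Q x) = n (f x, fderiv ℝ f x (lieBracket ℝ V W x)) := by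
  have hV' : fderiv ℝ (fun y => fderiv ℝ f y (V y)) x = 0 := by
    rw [EventuallyEq.fderiv_eq (show (fun y => fderiv ℝ f y (V y)) =ᶠ[𝓝 x] fun _ => 0 from hV0)]; simp
  rw [fderiv_apply_lieBracket_two hf hV hQ, fderiv_apply_lieBracket_two hf hV hW, hV',
    EventuallyEq.fderiv_eq hWQ, fderiv_comp_fibrewise_linear (hn _) hl
      (hf.differentiableAt two_ne_zero) (differentiableAt_fderiv_apply hf hW), hV0.self_of_nhds]
  have : ((0 : B), (0 : B)) = 0 := rfl
  simp [this]

/-- Every vector of the kernel of a surjective strict derivative is tangent to the fibre. -/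
theorem HasStrictFDerivAt.exists_isLittleO_fibre [CompleteSpace E] [CompleteSpace B] {f : E → B}
    {f' : E →L[ℝ] B} {a : E} (hf : HasStrictFDerivAt f f' a) (hsurj : Function.Surjective f')
    {v : E} (hv : f' v = 0) :
    ∃ γ : ℝ → E, (∀ᶠ t in 𝓝 0, f (γ t) = f a) ∧
      (fun t => γ t - a - t • v) =o[𝓝 0] (fun t => t) := by
  obtain ⟨φ, hφ⟩ := f'.exists_nonlinearRightInverse_of_surjective
    (LinearMap.range_eq_top.2 hsurj)
  -- With error constant `c`, half the inverse norm of the right inverse `φ`, the image of the ball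
  -- of radius `ε` about `a + tv` covers the ball of radius `cε` about `f(a + tv)`. So `a + tv` can
  -- be moved into the fibre by at most `c⁻¹‖f(a + tv) - f a‖`, which is `o(t)` because `f' v = 0`.
  -- No complement of the kernel is needed.
  obtain ⟨s, hs, happ⟩ := hf.approximates_deriv_on_nhds (c := φ.nnnorm⁻¹ / 2)
    (Or.inr (half_pos (inv_pos.2 hφ)))
  obtain ⟨r, hr, hrs⟩ := Metric.mem_nhds_iff.1 hs
  set c : ℝ := (φ.nnnorm : ℝ)⁻¹ / 2 with hc
  have hc0 : 0 < c := half_pos (inv_pos.2 (by exact_mod_cast hφ))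
  have hline : HasDerivAt (fun t : ℝ => a + t • v) v 0 := by
    simpa using ((hasDerivAt_id (0 : ℝ)).smul_const v).const_add a
  have hlo : (fun t : ℝ => f (a + t • v) - f a) =o[𝓝 0] (fun t => t) := by
    have h0 : HasFDerivAt f f' (a + (0 : ℝ) • v) := by simpa using hf.hasFDerivAt
    have := (h0.comp_hasDerivAt (0 : ℝ) hline).isLittleO
    simpa [hv] using this
  have hmove : Tendsto (fun t : ℝ => a + t • v) (𝓝 0) (𝓝 a) := by
    simpa using hline.continuousAt.tendsto
  have hz : Tendsto (fun t : ℝ => c⁻¹ * ‖f (a + t • v) - f a‖) (𝓝 0) (𝓝 0) := by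
    have := (hlo.trans_tendsto tendsto_id).norm.const_mul c⁻¹
    simpa using this
  have key : ∀ᶠ t : ℝ in 𝓝 0, ∃ y, f y = f a ∧
      ‖y - (a + t • v)‖ ≤ c⁻¹ * ‖f (a + t • v) - f a‖ := by
    filter_upwards [hmove (Metric.ball_mem_nhds a (half_pos hr)),
      hz (Metric.ball_mem_nhds 0 (half_pos hr))] with t h1 h2
    simp only [Set.mem_preimage, Metric.mem_ball, dist_zero_right] at h1 h2
    set ε := c⁻¹ * ‖f (a + t • v) - f a‖ with hε
    have hε0 : 0 ≤ ε := by positivity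
    rw [Real.norm_of_nonneg hε0] at h2
    have hsub : Metric.closedBall (a + t • v) ε ⊆ s := by
      refine subset_trans (fun z hz => ?_) hrs
      rw [Metric.mem_closedBall] at hz
      rw [Metric.mem_ball]
      linarith [dist_triangle z (a + t • v) a]
    have hmem : f a ∈ Metric.closedBall (f (a + t • v))
        (((φ.nnnorm : ℝ)⁻¹ - (φ.nnnorm⁻¹ / 2 : NNReal)) * ε) := by
      have : ((φ.nnnorm : ℝ)⁻¹ - (φ.nnnorm⁻¹ / 2 : NNReal)) = c := by
        rw [hc]; push_cast; ring
      rw [this, hε, mul_inv_cancel_left₀ hc0.ne', Metric.mem_closedBall, dist_comm, dist_eq_norm]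
    obtain ⟨y, hy, hfy⟩ := happ.surjOn_closedBall_of_nonlinearRightInverse φ hε0 hsub hmem
    exact ⟨y, hfy, by simpa [dist_eq_norm] using hy⟩
  classical
  refine ⟨fun t => if h : ∃ y, f y = f a ∧ ‖y - (a + t • v)‖ ≤ c⁻¹ * ‖f (a + t • v) - f a‖ then
    h.choose else a, ?_, ?_⟩
  · filter_upwards [key] with t ht
    rw [dif_pos ht]
    exact ht.choose_spec.1
  · refine IsBigO.trans_isLittleO (IsBigO.of_bound c⁻¹ ?_) hlo
    filter_upwards [key] with t ht
    rw [dif_pos ht, sub_sub]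
    exact ht.choose_spec.2

/-- A curve in the image of an immersion with closed range has its velocity in the range of the
derivative. -/
theorem mem_range_of_isLittleO_curve [CompleteSpace E] [CompleteSpace F] {ι : F → E}
    {ι' : F →L[ℝ] E} {p : F} (hι : HasFDerivAt ι ι' p) (hinj : Function.Injective ι')
    (hcl : IsClosed (Set.range ι')) {c : ℝ → F} (hc : Tendsto c (𝓝[≠] 0) (𝓝 p)) {v : E}
    (hv : (fun t => ι (c t) - ι p - t • v) =o[𝓝[≠] 0] (fun t : ℝ => t)) :
    v ∈ Set.range ι' := by
  obtain ⟨K, hK⟩ := ι'.antilipschitz_of_injective_of_isClosed_range hinj hcl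
  have h1 : (fun t => ι (c t) - ι p - ι' (c t - p)) =o[𝓝[≠] 0] (fun t => c t - p) :=
    hι.isLittleO.comp_tendsto hc
  have h2 : (fun t => c t - p) =O[𝓝[≠] 0] (fun t => ι' (c t - p)) := by
    refine IsBigO.of_bound K (Eventually.of_forall fun t => ?_)
    exact ZeroHomClass.bound_of_antilipschitz ι' hK _
  -- The curve `c` is only assumed to converge. The lower bound on `ι'` makes `c t - p` of order `ι
  -- (c t) - ι p`, hence of order `t`.
  have h3 : (fun t => c t - p) =O[𝓝[≠] 0] (fun t => ι (c t) - ι p) := by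
    have := (h1.trans_isBigO h2).right_isBigO_add
    refine h2.trans (this.congr_right fun t => by abel)
  have h4 : (fun t => ι (c t) - ι p) =O[𝓝[≠] 0] (fun t : ℝ => t) := by
    have : (fun t : ℝ => t • v) =O[𝓝[≠] 0] (fun t : ℝ => t) :=
      IsBigO.of_bound ‖v‖ (Eventually.of_forall fun t => by rw [norm_smul, mul_comm])
    exact (hv.isBigO.add this).congr_left fun t => by abel
  have h5 : (fun t => t • v - ι' (c t - p)) =o[𝓝[≠] 0] (fun t : ℝ => t) :=
    ((h1.trans_isBigO (h3.trans h4)).sub hv).congr_left fun t => by abel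
  -- The images of the difference quotients converge to `v`, so closedness of the range suffices to
  -- conclude.
  have h6 : Tendsto (fun t : ℝ => ι' (t⁻¹ • (c t - p))) (𝓝[≠] 0) (𝓝 v) := by
    rw [← tendsto_sub_nhds_zero_iff]
    have h7 : (fun t : ℝ => t⁻¹ • (ι' (c t - p) - t • v)) =o[𝓝[≠] 0] (fun t : ℝ => t⁻¹ • t) :=
      (isBigO_refl _ _).smul_isLittleO (h5.neg_left.congr_left fun t => by abel)
    have h8 : (fun t : ℝ => t⁻¹ • (ι' (c t - p) - t • v)) =o[𝓝[≠] 0] (fun _ : ℝ => (1 : ℝ)) :=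
      h7.trans_isBigO (IsBigO.of_bound 1 (by
        filter_upwards [self_mem_nhdsWithin] with t ht
        rw [smul_eq_mul, inv_mul_cancel₀ ht, one_mul]))
    refine ((isLittleO_one_iff ℝ).1 h8).congr' ?_
    filter_upwards [self_mem_nhdsWithin] with t ht
    rw [smul_sub, inv_smul_smul₀ ht, map_smul]
  exact hcl.mem_of_tendsto h6 (Eventually.of_forall fun t => ⟨_, rfl⟩)

end Flat

/-! ### Tangent vectors, fields and maps in charts -/

section Charts

open Filter Topology VectorField Bundle

section MapInChart

variable {E : Type*} [NormedAddCommGroup E] [NormedSpace ℝ E]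
  {M : Type*} [TopologicalSpace M] [ChartedSpace E M]
  {E₀ : Type*} [NormedAddCommGroup E₀] [NormedSpace ℝ E₀]
  {M₀ : Type*} [TopologicalSpace M₀] [ChartedSpace E₀ M₀]

variable (E E₀) in
/-- A map between manifolds, read in charts. -/
noncomputable def mapInChart (τ : M → M₀) (x : M) : E → E₀ :=
  extChartAt 𝓘(ℝ, E₀) (τ x) ∘ τ ∘ (extChartAt 𝓘(ℝ, E) x).symm

theorem mapInChart_apply (τ : M → M₀) {x y : M} (hy : y ∈ (chartAt E x).source) :
    mapInChart E E₀ τ x (extChartAt 𝓘(ℝ, E) x y) = extChartAt 𝓘(ℝ, E₀) (τ x) (τ y) := by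
  have hy' : y ∈ (extChartAt 𝓘(ℝ, E) x).source := by rwa [extChartAt_source]
  simp only [mapInChart, Function.comp_apply, (extChartAt 𝓘(ℝ, E) x).left_inv hy']

end MapInChart

variable {E : Type*} [NormedAddCommGroup E] [NormedSpace ℝ E]
  {M : Type*} [TopologicalSpace M] [ChartedSpace E M] [IsManifold 𝓘(ℝ, E) ∞ M]
  {E₀ : Type*} [NormedAddCommGroup E₀] [NormedSpace ℝ E₀]
  {M₀ : Type*} [TopologicalSpace M₀] [ChartedSpace E₀ M₀] [IsManifold 𝓘(ℝ, E₀) ∞ M₀]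

/-- The coordinates of a tangent vector at `y` in the chart around `x`. -/
noncomputable def tangentCoord (x y : M) : TangentSpace 𝓘(ℝ, E) y →L[ℝ] E :=
  (trivializationAt E (TangentSpace 𝓘(ℝ, E)) x).continuousLinearMapAt ℝ y

/-- The tangent vector at `y` with given coordinates in the chart around `x`. -/
noncomputable def tangentOfCoord (x y : M) : E →L[ℝ] TangentSpace 𝓘(ℝ, E) y :=
  (trivializationAt E (TangentSpace 𝓘(ℝ, E)) x).symmL ℝ y

theorem tangentOfCoord_tangentCoord {x y : M} (hy : y ∈ (chartAt E x).source)
    (v : TangentSpace 𝓘(ℝ, E) y) : tangentOfCoord x y (tangentCoord x y v) = v :=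
  (trivializationAt E (TangentSpace 𝓘(ℝ, E)) x).symmL_continuousLinearMapAt (by simpa using hy) v

theorem tangentCoord_tangentOfCoord {x y : M} (hy : y ∈ (chartAt E x).source) (b : E) :
    tangentCoord x y (tangentOfCoord (E := E) x y b) = b :=
  (trivializationAt E (TangentSpace 𝓘(ℝ, E)) x).continuousLinearMapAt_symmL (by simpa using hy) b

theorem tangentCoord_injective {x y : M} (hy : y ∈ (chartAt E x).source) :
    Function.Injective (tangentCoord (E := E) x y) :=
  Function.LeftInverse.injective (tangentOfCoord_tangentCoord hy)

theorem tangentCoord_eq_mfderiv {x y : M} (hy : y ∈ (chartAt E x).source)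
    (v : TangentSpace 𝓘(ℝ, E) y) :
    tangentCoord x y v = mfderiv 𝓘(ℝ, E) 𝓘(ℝ, E) (extChartAt 𝓘(ℝ, E) x) y v := by
  rw [tangentCoord, TangentBundle.continuousLinearMapAt_trivializationAt hy]
  rfl

theorem contMDiffAt_tangentCoord (x : M) {p : TangentBundle 𝓘(ℝ, E) M}
    (hp : p.1 ∈ (chartAt E x).source) :
    ContMDiffAt (𝓘(ℝ, E).tangent) 𝓘(ℝ, E) ∞
      (fun q : TangentBundle 𝓘(ℝ, E) M => tangentCoord x q.1 q.2) p := by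
  set e := trivializationAt E (TangentSpace 𝓘(ℝ, E)) x with he
  have hs : IsOpen e.source := e.open_source
  have hb : ∀ q : TangentBundle 𝓘(ℝ, E) M, q ∈ e.source ↔ q.1 ∈ (chartAt E x).source := by
    intro q; rw [e.mem_source]; simp [he]
  have h1 := (e.contMDiffOn (n := ∞) (IB := 𝓘(ℝ, E))).contMDiffAt (hs.mem_nhds ((hb p).2 hp))
  refine (contMDiffAt_snd.comp p h1).congr_of_eventuallyEq ?_
  filter_upwards [hs.mem_nhds ((hb p).2 hp)] with q hq
  have hq' : q.1 ∈ e.baseSet := e.mem_source.1 hq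
  simp only [tangentCoord, Function.comp_apply]
  exact e.continuousLinearMapAt_apply_of_mem ℝ hq' q.2

theorem contMDiffAt_tangentOfCoord (x : M) {y : M} (b : E) (hy : y ∈ (chartAt E x).source) :
    ContMDiffAt (𝓘(ℝ, E).prod 𝓘(ℝ, E)) (𝓘(ℝ, E).tangent) ∞
      (fun q : M × E => (⟨q.1, tangentOfCoord x q.1 q.2⟩ : TangentBundle 𝓘(ℝ, E) M)) (y, b) := by
  set e := trivializationAt E (TangentSpace 𝓘(ℝ, E)) x with he
  have hs : IsOpen e.target := e.open_target
  have hb : ∀ q : M × E, q ∈ e.target ↔ q.1 ∈ (chartAt E x).source := by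
    intro q; rw [e.mem_target]; simp [he]
  have h1 := (e.contMDiffOn_symm (n := ∞) (IB := 𝓘(ℝ, E))).contMDiffAt
    (hs.mem_nhds ((hb (y, b)).2 hy))
  refine h1.congr_of_eventuallyEq ?_
  filter_upwards [hs.mem_nhds ((hb (y, b)).2 hy)] with q hq
  refine Eq.trans ?_ (e.mk_symm (e.mem_target.1 hq) q.2)
  rw [tangentOfCoord, e.symmL_apply (R := ℝ) (e.mem_target.1 hq)]

theorem exists_contMDiffOn_field (x : M) (v : TangentSpace 𝓘(ℝ, E) x) :
    ∃ X : ∀ y : M, TangentSpace 𝓘(ℝ, E) y, ContMDiffOn 𝓘(ℝ, E) (𝓘(ℝ, E).tangent) ∞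
      (fun y => (⟨y, X y⟩ : TangentBundle 𝓘(ℝ, E) M)) (chartAt E x).source ∧ X x = v := by
  refine ⟨fun y => tangentOfCoord x y (tangentCoord x x v), fun y hy => ?_,
    tangentOfCoord_tangentCoord (mem_chart_source E x) v⟩
  exact ((contMDiffAt_tangentOfCoord x (tangentCoord x x v) hy).comp y
    (contMDiffAt_id.prodMk contMDiffAt_const)).contMDiffWithinAt

/-- A vector field in the chart around `x`. -/
noncomputable def fieldInChart (x : M) (V : ∀ y : M, TangentSpace 𝓘(ℝ, E) y) (z : E) : E :=
  tangentCoord x ((extChartAt 𝓘(ℝ, E) x).symm z) (V ((extChartAt 𝓘(ℝ, E) x).symm z))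

theorem fieldInChart_self (x : M) (V : ∀ y : M, TangentSpace 𝓘(ℝ, E) y) :
    fieldInChart x V (extChartAt 𝓘(ℝ, E) x x) = tangentCoord x x (V x) := by
  rw [fieldInChart, extChartAt_to_inv]

theorem differentiableAt_fieldInChart {x : M} {V : ∀ y : M, TangentSpace 𝓘(ℝ, E) y}
    (hV : ContMDiffAt 𝓘(ℝ, E) (𝓘(ℝ, E).tangent) 1
      (fun y => (⟨y, V y⟩ : TangentBundle 𝓘(ℝ, E) M)) x) :
    DifferentiableAt ℝ (fieldInChart x V) (extChartAt 𝓘(ℝ, E) x x) := by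
  have h1 : ContMDiffAt 𝓘(ℝ, E) 𝓘(ℝ, E) 1 (extChartAt 𝓘(ℝ, E) x).symm
      (extChartAt 𝓘(ℝ, E) x x) :=
    (contMDiffOn_extChartAt_symm x).contMDiffAt (extChartAt_target_mem_nhds x)
  have h2 := ContMDiffAt.comp_of_eq (y := x) hV h1 (extChartAt_to_inv x)
  have h3 := ContMDiffAt.comp (extChartAt 𝓘(ℝ, E) x x)
    ((contMDiffAt_tangentCoord x (by simp)).of_le (by simp)) h2
  exact (contMDiffAt_iff_contDiffAt.1 h3).differentiableAt one_ne_zero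

theorem tangentCoord_mlieBracket (x : M) (V W : ∀ y : M, TangentSpace 𝓘(ℝ, E) y) :
    tangentCoord x x (mlieBracket 𝓘(ℝ, E) V W x) =
      lieBracket ℝ (fieldInChart x V) (fieldInChart x W) (extChartAt 𝓘(ℝ, E) x x) := by
  -- The bracket on `M` is computed from pullbacks of the fields along the inverse chart; these
  -- agree with `fieldInChart` near the centre, which is enough since brackets are local.
  have hev : ∀ V : ∀ y : M, TangentSpace 𝓘(ℝ, E) y,
      fieldInChart x V =ᶠ[𝓝 (extChartAt 𝓘(ℝ, E) x x)]
      mpullbackWithin 𝓘(ℝ, E) 𝓘(ℝ, E) (extChartAt 𝓘(ℝ, E) x).symm V (Set.range 𝓘(ℝ, E)) := by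
    intro V
    filter_upwards [extChartAt_target_mem_nhds (I := 𝓘(ℝ, E)) x] with z hz
    have hs : (extChartAt 𝓘(ℝ, E) x).symm z ∈ (chartAt E x).source := by
      rw [← extChartAt_source 𝓘(ℝ, E)]; exact (extChartAt 𝓘(ℝ, E) x).map_target hz
    rw [fieldInChart, tangentCoord_eq_mfderiv hs, mpullbackWithin_apply]
    exact ((isInvertible_mfderivWithin_extChartAt_symm hz).inverse_apply_eq.2
      (DFunLike.congr_fun
        (mfderivWithin_extChartAt_symm_comp_mfderiv_extChartAt hz) _).symm).symm
  have hl : ∀ A B : E → E, lieBracketWithin ℝ A B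
      ((extChartAt 𝓘(ℝ, E) x).symm ⁻¹' Set.univ ∩ Set.range 𝓘(ℝ, E)) (extChartAt 𝓘(ℝ, E) x x) =
      lieBracket ℝ A B (extChartAt 𝓘(ℝ, E) x x) := fun A B => by
    rw [Set.preimage_univ, Set.univ_inter, modelWithCornersSelf_coe, Set.range_id,
      lieBracketWithin_univ]
  rw [(hev V).lieBracket_vectorField_eq (hev W), tangentCoord_eq_mfderiv (mem_chart_source E x)]
  exact ((isInvertible_mfderiv_extChartAt
    (I := 𝓘(ℝ, E)) (mem_extChartAt_source x)).self_apply_inverse _).trans (hl _ _)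

theorem contDiffAt_mapInChart {τ : M → M₀} {x y : M} (hτ : ContMDiffAt 𝓘(ℝ, E) 𝓘(ℝ, E₀) ∞ τ y)
    (hy : y ∈ (chartAt E x).source) (hy₀ : τ y ∈ (chartAt E₀ (τ x)).source) :
    ContDiffAt ℝ ∞ (mapInChart E E₀ τ x) (extChartAt 𝓘(ℝ, E) x y) := by
  have hy' : y ∈ (extChartAt 𝓘(ℝ, E) x).source := by rwa [extChartAt_source]
  have h1 : ContMDiffAt 𝓘(ℝ, E) 𝓘(ℝ, E) ∞ (extChartAt 𝓘(ℝ, E) x).symm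
      (extChartAt 𝓘(ℝ, E) x y) :=
    (contMDiffOn_extChartAt_symm x).contMDiffAt (extChartAt_target_mem_nhds' ((extChartAt 𝓘(ℝ, E) x).map_source hy'))
  have hinv := (extChartAt 𝓘(ℝ, E) x).left_inv hy'
  have h2 := ContMDiffAt.comp_of_eq hτ h1 hinv
  have h3 := ContMDiffAt.comp_of_eq (contMDiffAt_extChartAt' (I := 𝓘(ℝ, E₀)) (n := ∞) hy₀) h2
    (by rw [Function.comp_apply, hinv])
  exact contMDiffAt_iff_contDiffAt.1 h3

theorem fderiv_mapInChart {τ : M → M₀} {x y : M} (hτ : ContMDiffAt 𝓘(ℝ, E) 𝓘(ℝ, E₀) ∞ τ y)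
    (hy : y ∈ (chartAt E x).source) (hy₀ : τ y ∈ (chartAt E₀ (τ x)).source)
    (v : TangentSpace 𝓘(ℝ, E) y) :
    fderiv ℝ (mapInChart E E₀ τ x) (extChartAt 𝓘(ℝ, E) x y) (tangentCoord x y v) =
      tangentCoord (τ x) (τ y) (mfderiv 𝓘(ℝ, E) 𝓘(ℝ, E₀) τ y v) := by
  have hy' : y ∈ (extChartAt 𝓘(ℝ, E) x).source := by rwa [extChartAt_source]
  have h1 : MDifferentiableAt 𝓘(ℝ, E) 𝓘(ℝ, E₀) (mapInChart E E₀ τ x)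
      (extChartAt 𝓘(ℝ, E) x y) :=
    ((contDiffAt_mapInChart hτ hy hy₀).differentiableAt (by simp)).mdifferentiableAt
  have h2 : mapInChart E E₀ τ x ∘ extChartAt 𝓘(ℝ, E) x =ᶠ[𝓝 y]
      extChartAt 𝓘(ℝ, E₀) (τ x) ∘ τ := by
    filter_upwards [(chartAt E x).open_source.mem_nhds hy] with z hz
    exact mapInChart_apply τ hz
  have h3 := h2.mfderiv_eq (I := 𝓘(ℝ, E)) (I' := 𝓘(ℝ, E₀))
  rw [mfderiv_comp y h1 (mdifferentiableAt_extChartAt hy),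
    mfderiv_comp y (mdifferentiableAt_extChartAt hy₀) (hτ.mdifferentiableAt (by simp))] at h3
  rw [tangentCoord_eq_mfderiv hy, tangentCoord_eq_mfderiv hy₀, ← mfderiv_eq_fderiv]
  exact DFunLike.congr_fun h3 v

/-- The neighbourhood and the point `y` do not depend on the field, so relations between several
fields can be read off at the same `y`. -/
theorem eventually_fderiv_mapInChart_fieldInChart {τ : M → M₀} (hτ : ContMDiff 𝓘(ℝ, E) 𝓘(ℝ, E₀) ∞ τ) (x : M) :
    ∀ᶠ z in 𝓝 (extChartAt 𝓘(ℝ, E) x x), ∃ y, z = extChartAt 𝓘(ℝ, E) x y ∧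
      y ∈ (chartAt E x).source ∧ τ y ∈ (chartAt E₀ (τ x)).source ∧
      ∀ V : ∀ y : M, TangentSpace 𝓘(ℝ, E) y,
        fderiv ℝ (mapInChart E E₀ τ x) z (fieldInChart x V z) =
          tangentCoord (τ x) (τ y) (mfderiv 𝓘(ℝ, E) 𝓘(ℝ, E₀) τ y (V y)) := by
  have hc : ContinuousAt (τ ∘ (extChartAt 𝓘(ℝ, E) x).symm) (extChartAt 𝓘(ℝ, E) x x) :=
    hτ.continuous.continuousAt.comp (continuousAt_extChartAt_symm x)
  have h0 : (chartAt E₀ (τ x)).source ∈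
      𝓝 ((τ ∘ (extChartAt 𝓘(ℝ, E) x).symm) (extChartAt 𝓘(ℝ, E) x x)) := by
    rw [Function.comp_apply, extChartAt_to_inv]
    exact chart_source_mem_nhds E₀ (τ x)
  filter_upwards [extChartAt_target_mem_nhds (I := 𝓘(ℝ, E)) x, hc h0] with z hz hz₀
  have hy := (extChartAt 𝓘(ℝ, E) x).map_target hz
  rw [extChartAt_source] at hy
  have hinv := (extChartAt 𝓘(ℝ, E) x).right_inv hz
  refine ⟨(extChartAt 𝓘(ℝ, E) x).symm z, hinv.symm, hy, hz₀, fun V => ?_⟩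
  rw [← fderiv_mapInChart hτ.contMDiffAt hy hz₀, hinv]
  rfl

theorem eventually_fderiv_mapInChart_fieldInChart_eq_zero
    {τ : M → M₀} (hτ : ContMDiff 𝓘(ℝ, E) 𝓘(ℝ, E₀) ∞ τ) (x : M) {V : ∀ y : M, TangentSpace 𝓘(ℝ, E) y}
    (hV0 : ∀ y, mfderiv 𝓘(ℝ, E) 𝓘(ℝ, E₀) τ y (V y) = 0) :
    ∀ᶠ z in 𝓝 (extChartAt 𝓘(ℝ, E) x x),
      fderiv ℝ (mapInChart E E₀ τ x) z (fieldInChart x V z) = 0 := by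
  filter_upwards [eventually_fderiv_mapInChart_fieldInChart hτ x] with z ⟨y, _, _, _, h⟩
  rw [h, hV0, map_zero]

/-! ### `𝒩`-operators in charts and their projections -/

namespace NOperator

/-- An `𝒩`-operator in the chart around `x`. -/
noncomputable def inChart (N : NOperator E M) (x : M) (q : E × E) : E :=
  tangentCoord x ((extChartAt 𝓘(ℝ, E) x).symm q.1)
    (N.op _ (tangentOfCoord x ((extChartAt 𝓘(ℝ, E) x).symm q.1) q.2))

theorem inChart_apply (N : NOperator E M) {x y : M} (hy : y ∈ (chartAt E x).source)
    (v : TangentSpace 𝓘(ℝ, E) y) :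
    N.inChart x (extChartAt 𝓘(ℝ, E) x y, tangentCoord x y v) = tangentCoord x y (N.op y v) := by
  have hy' : y ∈ (extChartAt 𝓘(ℝ, E) x).source := by rwa [extChartAt_source]
  simp only [inChart]
  rw [(extChartAt 𝓘(ℝ, E) x).left_inv hy', tangentOfCoord_tangentCoord hy]

theorem exists_inChart_eq (N : NOperator E M) (x : M) (z : E) :
    ∃ ℓ : E →L[ℝ] E, ∀ b, N.inChart x (z, b) = ℓ b :=
  ⟨(tangentCoord x ((extChartAt 𝓘(ℝ, E) x).symm z)).comp
    ((N.op _).comp (tangentOfCoord x ((extChartAt 𝓘(ℝ, E) x).symm z))), fun _ => rfl⟩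

theorem differentiableAt_inChart (N : NOperator E M) (x : M) (b : E) :
    DifferentiableAt ℝ (N.inChart x) (extChartAt 𝓘(ℝ, E) x x, b) := by
  have h0 : ContMDiffAt 𝓘(ℝ, E × E) (𝓘(ℝ, E).prod 𝓘(ℝ, E)) ∞
      (fun q : E × E => ((extChartAt 𝓘(ℝ, E) x).symm q.1, q.2)) (extChartAt 𝓘(ℝ, E) x x, b) := by
    have h1 : ContMDiffAt 𝓘(ℝ, E) 𝓘(ℝ, E) ∞ (extChartAt 𝓘(ℝ, E) x).symm
        (extChartAt 𝓘(ℝ, E) x x) :=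
      (contMDiffOn_extChartAt_symm x).contMDiffAt (extChartAt_target_mem_nhds x)
    exact (ContMDiffAt.comp (extChartAt 𝓘(ℝ, E) x x, b) h1
      contDiffAt_fst.contMDiffAt).prodMk contDiffAt_snd.contMDiffAt
  have h1 := ContMDiffAt.comp_of_eq
    (contMDiffAt_tangentOfCoord x b (mem_chart_source E x)) h0 (by simp)
  have h2 := ContMDiffAt.comp (extChartAt 𝓘(ℝ, E) x x, b) N.smooth_op.contMDiffAt h1
  have h3 := ContMDiffAt.comp (extChartAt 𝓘(ℝ, E) x x, b)
    (contMDiffAt_tangentCoord x (by simp)) h2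
  exact (contMDiffAt_iff_contDiffAt.1 h3).differentiableAt (by simp)

theorem contMDiffAt_onField (N : NOperator E M) {n : ℕ∞ω} (hn : n ≤ ∞) {x : M}
    {V : ∀ y : M, TangentSpace 𝓘(ℝ, E) y}
    (hV : ContMDiffAt 𝓘(ℝ, E) (𝓘(ℝ, E).tangent) n
      (fun y => (⟨y, V y⟩ : TangentBundle 𝓘(ℝ, E) M)) x) :
    ContMDiffAt 𝓘(ℝ, E) (𝓘(ℝ, E).tangent) n
      (fun y => (⟨y, N.onField V y⟩ : TangentBundle 𝓘(ℝ, E) M)) x :=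
  (N.smooth_op.of_le hn).contMDiffAt.comp x hV

section Projection

variable {τ : M → M₀} {N : NOperator E M} {N₀ : NOperator E₀ M₀}

theorem eventually_fderiv_mapInChart_onField (hτ : ContMDiff 𝓘(ℝ, E) 𝓘(ℝ, E₀) ∞ τ)
    (hN : ProjectsOnto τ N N₀) (x : M) (V : ∀ y : M, TangentSpace 𝓘(ℝ, E) y) :
    ∀ᶠ z in 𝓝 (extChartAt 𝓘(ℝ, E) x x),
      fderiv ℝ (mapInChart E E₀ τ x) z (fieldInChart x (N.onField V) z) =
        N₀.inChart (τ x) (mapInChart E E₀ τ x z,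
          fderiv ℝ (mapInChart E E₀ τ x) z (fieldInChart x V z)) := by
  filter_upwards [eventually_fderiv_mapInChart_fieldInChart hτ x] with z ⟨y, hz, hy, hy₀, h⟩
  rw [h, h, hz, mapInChart_apply τ hy, inChart_apply N₀ hy₀, hN]
  rfl

theorem fderiv_mapInChart_lieBracket (hτ : ContMDiff 𝓘(ℝ, E) 𝓘(ℝ, E₀) ∞ τ) (x : M)
    (V W : ∀ y : M, TangentSpace 𝓘(ℝ, E) y) :
    fderiv ℝ (mapInChart E E₀ τ x) (extChartAt 𝓘(ℝ, E) x x)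
        (lieBracket ℝ (fieldInChart x V) (fieldInChart x W) (extChartAt 𝓘(ℝ, E) x x)) =
      tangentCoord (τ x) (τ x)
        (mfderiv 𝓘(ℝ, E) 𝓘(ℝ, E₀) τ x (mlieBracket 𝓘(ℝ, E) V W x)) := by
  rw [← tangentCoord_mlieBracket, fderiv_mapInChart hτ.contMDiffAt (mem_chart_source E x)
    (mem_chart_source E₀ (τ x))]

theorem inChart_tangentCoord_mfderiv (hN : ProjectsOnto τ N N₀) (x : M)
    (v : TangentSpace 𝓘(ℝ, E) x) :
    N₀.inChart (τ x) (extChartAt 𝓘(ℝ, E₀) (τ x) (τ x),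
        tangentCoord (τ x) (τ x) (mfderiv 𝓘(ℝ, E) 𝓘(ℝ, E₀) τ x v)) =
      tangentCoord (τ x) (τ x) (mfderiv 𝓘(ℝ, E) 𝓘(ℝ, E₀) τ x (N.op x v)) := by
  rw [inChart_apply N₀ (mem_chart_source E₀ (τ x)), hN]

/-- The image under `Tτ` of the torsion of `N` is the torsion tensor of its projection `N₀`. -/
theorem tangentCoord_mfderiv_torsion (hτ : ContMDiff 𝓘(ℝ, E) 𝓘(ℝ, E₀) ∞ τ)
    (hN : ProjectsOnto τ N N₀) {x : M} {V W : ∀ y : M, TangentSpace 𝓘(ℝ, E) y}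
    (hV : ContMDiffAt 𝓘(ℝ, E) (𝓘(ℝ, E).tangent) 1
      (fun y => (⟨y, V y⟩ : TangentBundle 𝓘(ℝ, E) M)) x)
    (hW : ContMDiffAt 𝓘(ℝ, E) (𝓘(ℝ, E).tangent) 1
      (fun y => (⟨y, W y⟩ : TangentBundle 𝓘(ℝ, E) M)) x) :
    tangentCoord (τ x) (τ x) (mfderiv 𝓘(ℝ, E) 𝓘(ℝ, E₀) τ x (N.torsion V W x)) =
      torsionTensor (N₀.inChart (τ x)) (extChartAt 𝓘(ℝ, E₀) (τ x) (τ x))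
        (tangentCoord (τ x) (τ x) (mfderiv 𝓘(ℝ, E) 𝓘(ℝ, E₀) τ x (V x)))
        (tangentCoord (τ x) (τ x) (mfderiv 𝓘(ℝ, E) 𝓘(ℝ, E₀) τ x (W x))) := by
  have hx := mem_chart_source E x
  have hx₀ := mem_chart_source E₀ (τ x)
  obtain ⟨ℓ, hl⟩ := N₀.exists_inChart_eq (τ x) (mapInChart E E₀ τ x (extChartAt 𝓘(ℝ, E) x x))
  have hmap := mapInChart_apply (E := E) (E₀ := E₀) τ hx
  have key := fderiv_apply_torsion (n := N₀.inChart (τ x)) (ℓ := ℓ)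
    ((contDiffAt_mapInChart hτ.contMDiffAt hx hx₀).of_le ENat.LEInfty.out)
    (differentiableAt_fieldInChart hV) (differentiableAt_fieldInChart hW)
    (differentiableAt_fieldInChart (N.contMDiffAt_onField (by simp) hV))
    (differentiableAt_fieldInChart (N.contMDiffAt_onField (by simp) hW))
    (fun b => by rw [hmap]; exact N₀.differentiableAt_inChart (τ x) b) hl
    (eventually_fderiv_mapInChart_onField hτ hN x V)
    (eventually_fderiv_mapInChart_onField hτ hN x W)
  -- Every term of the flat identity becomes the coordinate expression of `Tτ` applied to a tangent
  -- vector of `M`.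
  simp only [fderiv_mapInChart_lieBracket hτ, fieldInChart_self,
    fderiv_mapInChart hτ.contMDiffAt hx hx₀, hmap, inChart_tangentCoord_mfderiv hN] at key
  rw [← key]
  simp only [torsion, map_sub, map_add, ← inChart_tangentCoord_mfderiv hN]
  rw [hmap] at hl
  simp only [hl, map_sub, map_add]

/-- Both terms of the pushed-forward bracket differentiate functions that vanish identically near
the point. -/
theorem mfderiv_mlieBracket_eq_zero (hτ : ContMDiff 𝓘(ℝ, E) 𝓘(ℝ, E₀) ∞ τ) {x : M}
    {V W : ∀ y : M, TangentSpace 𝓘(ℝ, E) y}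
    (hV : ContMDiffAt 𝓘(ℝ, E) (𝓘(ℝ, E).tangent) 1
      (fun y => (⟨y, V y⟩ : TangentBundle 𝓘(ℝ, E) M)) x)
    (hW : ContMDiffAt 𝓘(ℝ, E) (𝓘(ℝ, E).tangent) 1
      (fun y => (⟨y, W y⟩ : TangentBundle 𝓘(ℝ, E) M)) x)
    (hV0 : ∀ y, mfderiv 𝓘(ℝ, E) 𝓘(ℝ, E₀) τ y (V y) = 0)
    (hW0 : ∀ y, mfderiv 𝓘(ℝ, E) 𝓘(ℝ, E₀) τ y (W y) = 0) :
    mfderiv 𝓘(ℝ, E) 𝓘(ℝ, E₀) τ x (mlieBracket 𝓘(ℝ, E) V W x) = 0 := by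
  have hx₀ := mem_chart_source E₀ (τ x)
  refine tangentCoord_injective hx₀ ?_
  rw [map_zero, ← fderiv_mapInChart_lieBracket hτ, fderiv_apply_lieBracket_two
    ((contDiffAt_mapInChart hτ.contMDiffAt (mem_chart_source E x) hx₀).of_le ENat.LEInfty.out)
    (differentiableAt_fieldInChart hV) (differentiableAt_fieldInChart hW)]
  have h : ∀ {V : ∀ y : M, TangentSpace 𝓘(ℝ, E) y},
      (∀ y, mfderiv 𝓘(ℝ, E) 𝓘(ℝ, E₀) τ y (V y) = 0) →
      fderiv ℝ (fun z => fderiv ℝ (mapInChart E E₀ τ x) z (fieldInChart x V z))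
        (extChartAt 𝓘(ℝ, E) x x) = 0 := fun {V} hV0 => by
    have h0 : (fun z => fderiv ℝ (mapInChart E E₀ τ x) z (fieldInChart x V z))
        =ᶠ[𝓝 (extChartAt 𝓘(ℝ, E) x x)] fun _ => 0 :=
      eventually_fderiv_mapInChart_fieldInChart_eq_zero hτ x hV0
    rw [h0.fderiv_eq, fderiv_const_apply]
  rw [h hV0, h hW0]
  simp

/-- Brackets with a vertical field commute with `N` up to vertical vectors. -/
theorem mfderiv_mlieBracket_vertical (hτ : ContMDiff 𝓘(ℝ, E) 𝓘(ℝ, E₀) ∞ τ)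
    (hN : ProjectsOnto τ N N₀) {x : M} {V W : ∀ y : M, TangentSpace 𝓘(ℝ, E) y}
    (hV : ContMDiffAt 𝓘(ℝ, E) (𝓘(ℝ, E).tangent) 1
      (fun y => (⟨y, V y⟩ : TangentBundle 𝓘(ℝ, E) M)) x)
    (hW : ContMDiffAt 𝓘(ℝ, E) (𝓘(ℝ, E).tangent) 1
      (fun y => (⟨y, W y⟩ : TangentBundle 𝓘(ℝ, E) M)) x)
    (hV0 : ∀ y, mfderiv 𝓘(ℝ, E) 𝓘(ℝ, E₀) τ y (V y) = 0) :
    mfderiv 𝓘(ℝ, E) 𝓘(ℝ, E₀) τ x (mlieBracket 𝓘(ℝ, E) V (N.onField W) x) =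
      mfderiv 𝓘(ℝ, E) 𝓘(ℝ, E₀) τ x (N.op x (mlieBracket 𝓘(ℝ, E) V W x)) := by
  have hx := mem_chart_source E x
  have hx₀ := mem_chart_source E₀ (τ x)
  obtain ⟨ℓ, hl⟩ := N₀.exists_inChart_eq (τ x) (mapInChart E E₀ τ x (extChartAt 𝓘(ℝ, E) x x))
  have hmap := mapInChart_apply (E := E) (E₀ := E₀) τ hx
  have key := fderiv_apply_lieBracket_vertical (n := N₀.inChart (τ x)) (ℓ := ℓ)
    ((contDiffAt_mapInChart hτ.contMDiffAt hx hx₀).of_le ENat.LEInfty.out)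
    (differentiableAt_fieldInChart hV) (differentiableAt_fieldInChart hW)
    (differentiableAt_fieldInChart (N.contMDiffAt_onField (by simp) hW))
    (fun b => by rw [hmap]; exact N₀.differentiableAt_inChart (τ x) b) hl
    (eventually_fderiv_mapInChart_fieldInChart_eq_zero hτ x hV0)
    (eventually_fderiv_mapInChart_onField hτ hN x W)
  simp only [fderiv_mapInChart_lieBracket hτ, hmap, inChart_tangentCoord_mfderiv hN] at key
  exact tangentCoord_injective hx₀ key

end Projection

end NOperator

end Charts

/-! ### Curves in the fibres of submersions and in the images of immersions -/

section Fibres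

open Filter Topology Asymptotics

variable {E : Type*} [NormedAddCommGroup E] [NormedSpace ℝ E] [CompleteSpace E]
  {M : Type*} [TopologicalSpace M] [ChartedSpace E M] [IsManifold 𝓘(ℝ, E) ∞ M]
  {F : Type*} [NormedAddCommGroup F] [NormedSpace ℝ F] [CompleteSpace F]
  {P : Type*} [TopologicalSpace P] [ChartedSpace F P] [IsManifold 𝓘(ℝ, F) ∞ P]

/-- A vertical vector of a submersion is the velocity of a curve in the fibre. -/
theorem exists_curve_in_fibre {τ : M → P} {x : M} (hτ : ContMDiffAt 𝓘(ℝ, E) 𝓘(ℝ, F) ∞ τ x)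
    (hsurj : Function.Surjective (mfderiv 𝓘(ℝ, E) 𝓘(ℝ, F) τ x)) {v : TangentSpace 𝓘(ℝ, E) x}
    (hv : mfderiv 𝓘(ℝ, E) 𝓘(ℝ, F) τ x v = 0) :
    ∃ g : ℝ → M, Tendsto g (𝓝 0) (𝓝 x) ∧ (∀ᶠ t in 𝓝 0, τ (g t) = τ x) ∧
      (fun t => extChartAt 𝓘(ℝ, E) x (g t) - extChartAt 𝓘(ℝ, E) x x - t • tangentCoord x x v)
        =o[𝓝 0] (fun t => t) := by
  have hx := mem_chart_source E x
  have hx₀ := mem_chart_source F (τ x)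
  have hstrict := (contDiffAt_mapInChart hτ hx hx₀).hasStrictFDerivAt (by simp)
  obtain ⟨γ, hγ, ho⟩ := hstrict.exists_isLittleO_fibre
    (v := tangentCoord (E := E) x x v) (by
      intro b
      obtain ⟨w, hw⟩ := hsurj (tangentOfCoord (E := F) (τ x) (τ x) b)
      exact ⟨tangentCoord (E := E) x x w, by
        rw [fderiv_mapInChart hτ hx hx₀, hw, tangentCoord_tangentOfCoord hx₀]⟩)
    (by rw [fderiv_mapInChart hτ hx hx₀, hv, map_zero])
  have hlim : Tendsto γ (𝓝 0) (𝓝 (extChartAt 𝓘(ℝ, E) x x)) := by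
    have h1 : Tendsto (fun t : ℝ => extChartAt 𝓘(ℝ, E) x x + t • tangentCoord x x v) (𝓝 0)
        (𝓝 (extChartAt 𝓘(ℝ, E) x x)) := by
      have : Continuous (fun t : ℝ => extChartAt 𝓘(ℝ, E) x x + t • tangentCoord x x v) := by
        fun_prop
      simpa using this.tendsto 0
    have h2 := (ho.trans_tendsto tendsto_id).add h1
    rw [zero_add] at h2
    exact h2.congr fun t => by abel
  have hg : Tendsto (fun t => (extChartAt 𝓘(ℝ, E) x).symm (γ t)) (𝓝 0) (𝓝 x) := by
    have := (continuousAt_extChartAt_symm (I := 𝓘(ℝ, E)) x).tendsto.comp hlim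
    rwa [extChartAt_to_inv] at this
  refine ⟨fun t => (extChartAt 𝓘(ℝ, E) x).symm (γ t), hg, ?_, ?_⟩
  · filter_upwards [hγ, (hτ.continuousAt.tendsto.comp hg) (extChartAt_source_mem_nhds (I := 𝓘(ℝ, F)) (τ x))]
      with t h1 h2
    refine (extChartAt 𝓘(ℝ, F) (τ x)).injOn h2 (mem_extChartAt_source (τ x)) ?_
    rw [mapInChart_apply τ hx] at h1
    exact h1
  · refine ho.congr' ?_ EventuallyEq.rfl
    filter_upwards [hlim (extChartAt_target_mem_nhds x)] with t ht
    rw [(extChartAt 𝓘(ℝ, E) x).right_inv ht]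

/-- The velocity of a curve in the image of an immersion with closed range is tangent to it. -/
theorem mem_range_mfderiv_of_curve {ι : P → M} {p : P}
    (hι : ContMDiffAt 𝓘(ℝ, F) 𝓘(ℝ, E) ∞ ι p)
    (hinj : Function.Injective (mfderiv 𝓘(ℝ, F) 𝓘(ℝ, E) ι p))
    (hcl : IsClosed (Set.range (mfderiv 𝓘(ℝ, F) 𝓘(ℝ, E) ι p)))
    {c : ℝ → P} (hc : Tendsto c (𝓝 0) (𝓝 p)) {v : TangentSpace 𝓘(ℝ, E) (ι p)}
    (hv : (fun t => extChartAt 𝓘(ℝ, E) (ι p) (ι (c t)) - extChartAt 𝓘(ℝ, E) (ι p) (ι p)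
      - t • tangentCoord (ι p) (ι p) v) =o[𝓝 0] (fun t => t)) :
    v ∈ Set.range (mfderiv 𝓘(ℝ, F) 𝓘(ℝ, E) ι p) := by
  have hp := mem_chart_source F p
  have hp₀ := mem_chart_source E (ι p)
  have hd := (contDiffAt_mapInChart hι hp hp₀).differentiableAt (by simp)
  have hfd : ∀ b, fderiv ℝ (mapInChart F E ι p) (extChartAt 𝓘(ℝ, F) p p) b =
      tangentCoord (ι p) (ι p) (mfderiv 𝓘(ℝ, F) 𝓘(ℝ, E) ι p (tangentOfCoord p p b)) := by
    intro b
    rw [← fderiv_mapInChart hι hp hp₀, tangentCoord_tangentOfCoord hp]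
  have hrange : Set.range (fderiv ℝ (mapInChart F E ι p) (extChartAt 𝓘(ℝ, F) p p)) =
      tangentOfCoord (ι p) (ι p) ⁻¹' Set.range (mfderiv 𝓘(ℝ, F) 𝓘(ℝ, E) ι p) := by
    ext b
    constructor
    · rintro ⟨a, rfl⟩
      exact ⟨tangentOfCoord p p a, by rw [hfd, tangentOfCoord_tangentCoord hp₀]⟩
    · rintro ⟨w, hw⟩
      exact ⟨tangentCoord p p w, by
        rw [hfd, tangentOfCoord_tangentCoord hp, hw, tangentCoord_tangentOfCoord hp₀]⟩
  have key : tangentCoord (ι p) (ι p) v ∈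
      Set.range (fderiv ℝ (mapInChart F E ι p) (extChartAt 𝓘(ℝ, F) p p)) := by
    refine mem_range_of_isLittleO_curve hd.hasFDerivAt ?_ ?_
      (c := fun t => extChartAt 𝓘(ℝ, F) p (c t)) ?_ ?_
    · intro a b hab
      rw [hfd, hfd] at hab
      have h1 := hinj (tangentCoord_injective hp₀ hab)
      rw [← tangentCoord_tangentOfCoord hp a, h1, tangentCoord_tangentOfCoord hp]
    · rw [hrange]
      exact hcl.preimage (tangentOfCoord (ι p) (ι p)).continuous
    · exact ((continuousAt_extChartAt (I := 𝓘(ℝ, F)) p).tendsto.comp hc).mono_left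
        nhdsWithin_le_nhds
    · refine (hv.mono nhdsWithin_le_nhds).congr' ?_ EventuallyEq.rfl
      filter_upwards [nhdsWithin_le_nhds (hc (chart_source_mem_nhds F p))] with t ht
      rw [mapInChart_apply ι ht, mapInChart_apply ι hp]
  rw [hrange, Set.mem_preimage, tangentOfCoord_tangentCoord hp₀] at key
  exact key

end Fibres

/-! ### Left-invariant operators and the homogeneous space `G/K` -/

section Homogeneous

open Filter Topology Asymptotics

variable {E : Type*} [NormedAddCommGroup E] [NormedSpace ℝ E]
  {F : Type*} [NormedAddCommGroup F] [NormedSpace ℝ F]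
  {E₀ : Type*} [NormedAddCommGroup E₀] [NormedSpace ℝ E₀]
  {G : Type*} [TopologicalSpace G] [ChartedSpace E G] [Group G]

theorem mulInvariantVectorField_one (X : GroupLieAlgebra 𝓘(ℝ, E) G) :
    mulInvariantVectorField X (1 : G) = X := by
  have : (fun x : G => 1 * x) = id := by ext; simp
  rw [mulInvariantVectorField, this, mfderiv_id]
  rfl

variable [LieGroup 𝓘(ℝ, E) ∞ G]

theorem mulInvariantVectorField_surjective (g : G) (v : TangentSpace 𝓘(ℝ, E) g) :
    ∃ X : GroupLieAlgebra 𝓘(ℝ, E) G, mulInvariantVectorField X g = v := by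
  have hid : (g * ·) ∘ (g⁻¹ * ·) = (id : G → G) := by ext; simp
  have h1 : HasMFDerivAt 𝓘(ℝ, E) 𝓘(ℝ, E) (g⁻¹ * ·) g _ := (mdifferentiableAt_mul_left).hasMFDerivAt
  -- The chain rule asks for the derivative at `g⁻¹ * g`, which equals `1` only propositionally.
  have h2 : ∀ h : G, h = 1 → HasMFDerivAt 𝓘(ℝ, E) 𝓘(ℝ, E) (g * ·) h
      (show E →L[ℝ] E from mfderiv 𝓘(ℝ, E) 𝓘(ℝ, E) (g * ·) (1 : G)) := by
    rintro _ rfl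
    exact (mdifferentiableAt_mul_left).hasMFDerivAt
  have h3 := HasMFDerivAt.comp g (h2 _ (inv_mul_cancel g)) h1
  rw [hid] at h3
  exact ⟨_, DFunLike.congr_fun (hasMFDerivAt_unique h3 (hasMFDerivAt_id g)) v⟩

theorem contMDiffAt_one_mulInvariantVectorField (X : GroupLieAlgebra 𝓘(ℝ, E) G) (g : G) :
    ContMDiffAt 𝓘(ℝ, E) (𝓘(ℝ, E).tangent) 1
      (fun h : G => (⟨h, mulInvariantVectorField X h⟩ : TangentBundle 𝓘(ℝ, E) G)) g :=
  (contMDiffAt_mulInvariantVectorField X).of_le (by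
    rw [minSmoothness_of_isRCLikeNormedField]; norm_num)

namespace NOperator

/-- The torsion at a point depends only on the values of the vector fields there. -/
theorem tangentCoord_torsion {M : Type*} [TopologicalSpace M] [ChartedSpace E M]
    [IsManifold 𝓘(ℝ, E) ∞ M] (N : NOperator E M) {x : M}
    {V W : ∀ y : M, TangentSpace 𝓘(ℝ, E) y}
    (hV : ContMDiffAt 𝓘(ℝ, E) (𝓘(ℝ, E).tangent) 1
      (fun y => (⟨y, V y⟩ : TangentBundle 𝓘(ℝ, E) M)) x)
    (hW : ContMDiffAt 𝓘(ℝ, E) (𝓘(ℝ, E).tangent) 1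
      (fun y => (⟨y, W y⟩ : TangentBundle 𝓘(ℝ, E) M)) x) :
    tangentCoord x x (N.torsion V W x) = torsionTensor (N.inChart x) (extChartAt 𝓘(ℝ, E) x x)
      (tangentCoord x x (V x)) (tangentCoord x x (W x)) := by
  -- The projection formula for `τ = id` says that the torsion is a tensor.
  have hid : ProjectsOnto (id : M → M) N N := fun x v => by
    rw [mfderiv_id]; rfl
  have h := tangentCoord_mfderiv_torsion contMDiff_id hid hV hW
  rw [mfderiv_id] at h
  exact h

variable {N : NOperator E G}

theorem IsLeftInvariant.onField_mulInvariantVectorField (hN : N.IsLeftInvariant)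
    (X : GroupLieAlgebra 𝓘(ℝ, E) G) :
    N.onField (mulInvariantVectorField X) = mulInvariantVectorField (N.atOne X) :=
  funext fun g => hN g X

theorem IsLeftInvariant.torsion_mulInvariantVectorField [CompleteSpace E]
    (hN : N.IsLeftInvariant) (X Y : GroupLieAlgebra 𝓘(ℝ, E) G) (g : G) :
    N.torsion (mulInvariantVectorField X) (mulInvariantVectorField Y) g =
      mulInvariantVectorField (lieTorsion N.atOne X Y) g := by
  have hb : ∀ X Y : GroupLieAlgebra 𝓘(ℝ, E) G,
      VectorField.mlieBracket 𝓘(ℝ, E) (mulInvariantVectorField X) (mulInvariantVectorField Y) g =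
        mulInvariantVectorField ⁅X, Y⁆ g := fun X Y => by
    rw [GroupLieAlgebra.bracket_def, mulInvariantVector_mlieBracket]
  have hop : ∀ X : GroupLieAlgebra 𝓘(ℝ, E) G,
      N.op g (mulInvariantVectorField X g) = mulInvariantVectorField (N.atOne X) g := hN g
  have hsub : ∀ X Y : GroupLieAlgebra 𝓘(ℝ, E) G, mulInvariantVectorField (X - Y) g =
      mulInvariantVectorField X g - mulInvariantVectorField Y g := fun X Y => map_sub _ X Y
  have hadd : ∀ X Y : GroupLieAlgebra 𝓘(ℝ, E) G, mulInvariantVectorField (X + Y) g =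
      mulInvariantVectorField X g + mulInvariantVectorField Y g := fun X Y => map_add _ X Y
  simp only [torsion, lieTorsion, hN.onField_mulInvariantVectorField, hb, map_sub, map_add, hop,
    hsub, hadd]

end NOperator

section Quotient

variable {K : Subgroup G} [ChartedSpace F K] [ChartedSpace E₀ (G ⧸ K)]

/-- `k ↦ gkK` is constant on `K`, so its derivative at the identity of `K` vanishes. -/
theorem mfderiv_mk_mulInvariantVectorField_eq_zero (hK : IsEmbeddedBanachSubgroup E F K)
    (hτ : IsBanachFibration E E₀ (QuotientGroup.mk : G → G ⧸ K)) (g : G)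
    {X : GroupLieAlgebra 𝓘(ℝ, E) G} (hX : X ∈ subgroupLieAlgebra E F K) :
    mfderiv 𝓘(ℝ, E) 𝓘(ℝ, E₀) (QuotientGroup.mk : G → G ⧸ K) g (mulInvariantVectorField X g) =
      0 := by
  obtain ⟨w, rfl⟩ := hX
  have hι : HasMFDerivAt 𝓘(ℝ, F) 𝓘(ℝ, E) (fun k : K => (k : G)) 1 _ :=
    (hK.smooth.contMDiffAt.mdifferentiableAt (by simp)).hasMFDerivAt
  have hL : HasMFDerivAt 𝓘(ℝ, E) 𝓘(ℝ, E) (g * ·) (1 : G) _ :=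
    (mdifferentiableAt_mul_left).hasMFDerivAt
  have hmk : ∀ h : G, h = g → HasMFDerivAt 𝓘(ℝ, E) 𝓘(ℝ, E₀) (QuotientGroup.mk : G → G ⧸ K) h
      (show E →L[ℝ] E₀ from mfderiv 𝓘(ℝ, E) 𝓘(ℝ, E₀) (QuotientGroup.mk : G → G ⧸ K) g) := by
    rintro _ rfl
    exact (hτ.smooth.contMDiffAt.mdifferentiableAt (by simp)).hasMFDerivAt
  have h1 := HasMFDerivAt.comp (1 : K) (hmk _ (mul_one g)) (HasMFDerivAt.comp (1 : K) hL hι)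
  have hconst : (QuotientGroup.mk : G → G ⧸ K) ∘ (g * ·) ∘ (fun k : K => (k : G)) =
      fun _ => (g : G ⧸ K) := by
    ext k
    exact QuotientGroup.mk_mul_of_mem g k.2
  rw [hconst] at h1
  exact DFunLike.congr_fun (hasMFDerivAt_unique h1 (hasMFDerivAt_const _ _)) w

variable [LieGroup 𝓘(ℝ, F) ∞ K] [IsManifold 𝓘(ℝ, E₀) ∞ (G ⧸ K)]

/-- For the converse, a kernel vector is the velocity of a curve in the fibre `K`. As `K` has the
subspace topology, this curve also converges to the identity in `K`, and the closed-range immersion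
forces its velocity into `𝔨`. -/
theorem mem_subgroupLieAlgebra_iff [CompleteSpace E] [CompleteSpace F] [CompleteSpace E₀]
    (hK : IsEmbeddedBanachSubgroup E F K)
    (hτ : IsBanachFibration E E₀ (QuotientGroup.mk : G → G ⧸ K))
    {X : GroupLieAlgebra 𝓘(ℝ, E) G} :
    X ∈ subgroupLieAlgebra E F K ↔
      mfderiv 𝓘(ℝ, E) 𝓘(ℝ, E₀) (QuotientGroup.mk : G → G ⧸ K) 1 X = 0 := by
  constructor
  · intro hX
    have := mfderiv_mk_mulInvariantVectorField_eq_zero hK hτ 1 hX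
    rwa [mulInvariantVectorField_one] at this
  · intro hX
    obtain ⟨g, hg, hfib, ho⟩ := exists_curve_in_fibre hτ.smooth.contMDiffAt (hτ.submersion 1) hX
    have hmem : ∀ᶠ t in 𝓝 (0 : ℝ), g t ∈ K := by
      filter_upwards [hfib] with t ht
      have := QuotientGroup.eq.1 ht.symm
      simpa using this
    classical
    -- The default value `1` is irrelevant: `g t ∈ K` for all small `t`.
    let c : ℝ → K := fun t => if h : g t ∈ K then ⟨g t, h⟩ else 1
    have hcg : ∀ᶠ t in 𝓝 (0 : ℝ), (c t : G) = g t := by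
      filter_upwards [hmem] with t ht
      simp [c, ht]
    have hc : Tendsto c (𝓝 0) (𝓝 1) := by
      rw [tendsto_subtype_rng]
      exact hg.congr' (hcg.mono fun t ht => ht.symm)
    have := mem_range_mfderiv_of_curve (v := X) (hK.smooth.contMDiffAt) (hK.injective 1)
      (hK.closed_range 1) hc (by
        refine ho.congr' ?_ EventuallyEq.rfl
        filter_upwards [hcg] with t ht
        rw [ht]
        rfl)
    exact this

section Projectable

variable [CompleteSpace E] {N : NOperator E G} {N₀ : NOperator E₀ (G ⧸ K)}

/-- The torsion of the projection `N₀` is the image of the torsion of the Lie algebra. -/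
theorem NOperator.ProjectsOnto.torsion_eq
    (hτ : IsBanachFibration E E₀ (QuotientGroup.mk : G → G ⧸ K))
    (hp : NOperator.ProjectsOnto (QuotientGroup.mk : G → G ⧸ K) N N₀) (hN : N.IsLeftInvariant)
    {X₀ Y₀ : ∀ x : G ⧸ K, TangentSpace 𝓘(ℝ, E₀) x} {g : G} {X Y : GroupLieAlgebra 𝓘(ℝ, E) G}
    (hX₀ : ContMDiffAt 𝓘(ℝ, E₀) (𝓘(ℝ, E₀).tangent) 1
      (fun x => (⟨x, X₀ x⟩ : TangentBundle 𝓘(ℝ, E₀) (G ⧸ K))) (g : G ⧸ K))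
    (hY₀ : ContMDiffAt 𝓘(ℝ, E₀) (𝓘(ℝ, E₀).tangent) 1
      (fun x => (⟨x, Y₀ x⟩ : TangentBundle 𝓘(ℝ, E₀) (G ⧸ K))) (g : G ⧸ K))
    (hX : X₀ g = mfderiv 𝓘(ℝ, E) 𝓘(ℝ, E₀) (QuotientGroup.mk : G → G ⧸ K) g
      (mulInvariantVectorField X g))
    (hY : Y₀ g = mfderiv 𝓘(ℝ, E) 𝓘(ℝ, E₀) (QuotientGroup.mk : G → G ⧸ K) g
      (mulInvariantVectorField Y g)) :
    N₀.torsion X₀ Y₀ g = mfderiv 𝓘(ℝ, E) 𝓘(ℝ, E₀) (QuotientGroup.mk : G → G ⧸ K) g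
      (mulInvariantVectorField (lieTorsion N.atOne X Y) g) := by
  refine tangentCoord_injective (mem_chart_source E₀ (g : G ⧸ K)) ?_
  -- Both sides are the torsion tensor of `N₀` on the same two vectors; `X₀`, `Y₀` need to match the
  -- projected left-invariant fields at `g` only.
  rw [NOperator.tangentCoord_torsion N₀ hX₀ hY₀, hX, hY, ← hN.torsion_mulInvariantVectorField,
    NOperator.tangentCoord_mfderiv_torsion hτ.smooth hp
      (contMDiffAt_one_mulInvariantVectorField X g) (contMDiffAt_one_mulInvariantVectorField Y g)]

variable [CompleteSpace F] [CompleteSpace E₀]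

theorem NOperator.ProjectsOnto.atOne_mem (hK : IsEmbeddedBanachSubgroup E F K)
    (hτ : IsBanachFibration E E₀ (QuotientGroup.mk : G → G ⧸ K))
    (hp : NOperator.ProjectsOnto (QuotientGroup.mk : G → G ⧸ K) N N₀)
    {X : GroupLieAlgebra 𝓘(ℝ, E) G} (hX : X ∈ subgroupLieAlgebra E F K) :
    N.atOne X ∈ subgroupLieAlgebra E F K := by
  rw [mem_subgroupLieAlgebra_iff hK hτ] at hX ⊢
  have := hp 1 X
  rw [hX, map_zero] at this
  exact this.symm

theorem lie_mem_subgroupLieAlgebra (hK : IsEmbeddedBanachSubgroup E F K)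
    (hτ : IsBanachFibration E E₀ (QuotientGroup.mk : G → G ⧸ K))
    {X Y : GroupLieAlgebra 𝓘(ℝ, E) G} (hX : X ∈ subgroupLieAlgebra E F K)
    (hY : Y ∈ subgroupLieAlgebra E F K) : ⁅X, Y⁆ ∈ subgroupLieAlgebra E F K := by
  rw [mem_subgroupLieAlgebra_iff hK hτ, GroupLieAlgebra.bracket_def]
  exact NOperator.mfderiv_mlieBracket_eq_zero hτ.smooth
    (contMDiffAt_one_mulInvariantVectorField X 1) (contMDiffAt_one_mulInvariantVectorField Y 1)
    (fun g => mfderiv_mk_mulInvariantVectorField_eq_zero hK hτ g hX)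
    (fun g => mfderiv_mk_mulInvariantVectorField_eq_zero hK hτ g hY)

/-- The left-invariant field of `X ∈ 𝔨` is vertical everywhere, so its bracket commutes with `N`
modulo vertical vectors; left-invariance turns this into a statement on `𝔤`. -/
theorem NOperator.ProjectsOnto.lie_atOne_sub_mem (hK : IsEmbeddedBanachSubgroup E F K)
    (hτ : IsBanachFibration E E₀ (QuotientGroup.mk : G → G ⧸ K))
    (hp : NOperator.ProjectsOnto (QuotientGroup.mk : G → G ⧸ K) N N₀) (hN : N.IsLeftInvariant)
    {X : GroupLieAlgebra 𝓘(ℝ, E) G} (hX : X ∈ subgroupLieAlgebra E F K)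
    (Y : GroupLieAlgebra 𝓘(ℝ, E) G) :
    ⁅X, N.atOne Y⁆ - N.atOne ⁅X, Y⁆ ∈ subgroupLieAlgebra E F K := by
  have h := NOperator.mfderiv_mlieBracket_vertical hτ.smooth hp
    (contMDiffAt_one_mulInvariantVectorField X 1) (contMDiffAt_one_mulInvariantVectorField Y 1)
    (fun g => mfderiv_mk_mulInvariantVectorField_eq_zero hK hτ g hX)
  rw [hN.onField_mulInvariantVectorField] at h
  rw [mem_subgroupLieAlgebra_iff hK hτ, map_sub, sub_eq_zero]
  exact h

theorem NOperator.ProjectsOnto.isAlmostComplex_iff (hK : IsEmbeddedBanachSubgroup E F K)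
    (hτ : IsBanachFibration E E₀ (QuotientGroup.mk : G → G ⧸ K))
    (hp : NOperator.ProjectsOnto (QuotientGroup.mk : G → G ⧸ K) N N₀) (hN : N.IsLeftInvariant) :
    N₀.IsAlmostComplex ↔ ∀ X : GroupLieAlgebra 𝓘(ℝ, E) G,
      N.atOne (N.atOne X) + X ∈ subgroupLieAlgebra E F K := by
  constructor
  · intro h X
    rw [mem_subgroupLieAlgebra_iff hK hτ, map_add, ← eq_neg_iff_add_eq_zero, ← h]
    rw [hp, hp]
    rfl
  · intro h x v
    obtain ⟨g, rfl⟩ := hτ.surjective x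
    obtain ⟨u, rfl⟩ := hτ.submersion g v
    obtain ⟨X, rfl⟩ := mulInvariantVectorField_surjective g u
    have h1 := mfderiv_mk_mulInvariantVectorField_eq_zero hK hτ g (h X)
    have h2 : mulInvariantVectorField (N.atOne (N.atOne X) + X) g =
        mulInvariantVectorField (N.atOne (N.atOne X)) g + mulInvariantVectorField X g :=
      map_add _ _ _
    rw [h2, map_add, ← eq_neg_iff_add_eq_zero] at h1
    rw [hp, hp, ← h1, hN, hN]
    rfl

/-- Forward, local fields with prescribed values at the base coset suffice. Backward, each value of
a field on `G/K` is the projection of a value of a left-invariant field, and `torsion_eq` sees only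
values. -/
theorem NOperator.ProjectsOnto.isNijenhuis_iff (hK : IsEmbeddedBanachSubgroup E F K)
    (hτ : IsBanachFibration E E₀ (QuotientGroup.mk : G → G ⧸ K))
    (hp : NOperator.ProjectsOnto (QuotientGroup.mk : G → G ⧸ K) N N₀) (hN : N.IsLeftInvariant) :
    N₀.IsNijenhuis ↔ ∀ X Y : GroupLieAlgebra 𝓘(ℝ, E) G,
      lieTorsion N.atOne X Y ∈ subgroupLieAlgebra E F K := by
  constructor
  · intro h X Y
    obtain ⟨X₀, hX₀, hX⟩ := exists_contMDiffOn_field (E := E₀) ((1 : G) : G ⧸ K)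
      (mfderiv 𝓘(ℝ, E) 𝓘(ℝ, E₀) (QuotientGroup.mk : G → G ⧸ K) 1 (mulInvariantVectorField X 1))
    obtain ⟨Y₀, hY₀, hY⟩ := exists_contMDiffOn_field (E := E₀) ((1 : G) : G ⧸ K)
      (mfderiv 𝓘(ℝ, E) 𝓘(ℝ, E₀) (QuotientGroup.mk : G → G ⧸ K) 1 (mulInvariantVectorField Y 1))
    have hs := (chartAt E₀ ((1 : G) : G ⧸ K)).open_source
    have hm := mem_chart_source E₀ ((1 : G) : G ⧸ K)
    have h0 := h _ hs X₀ Y₀ hX₀ hY₀ _ hm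
    rw [hp.torsion_eq hτ hN ((hX₀.contMDiffAt (hs.mem_nhds hm)).of_le (by simp))
      ((hY₀.contMDiffAt (hs.mem_nhds hm)).of_le (by simp)) hX hY, mulInvariantVectorField_one] at h0
    exact (mem_subgroupLieAlgebra_iff hK hτ).2 h0
  · intro h U hU X₀ Y₀ hX₀ hY₀ x hx
    obtain ⟨g, rfl⟩ := hτ.surjective x
    obtain ⟨u, hu⟩ := hτ.submersion g (X₀ g)
    obtain ⟨w, hw⟩ := hτ.submersion g (Y₀ g)
    obtain ⟨X, rfl⟩ := mulInvariantVectorField_surjective g u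
    obtain ⟨Y, rfl⟩ := mulInvariantVectorField_surjective g w
    rw [hp.torsion_eq hτ hN ((hX₀.contMDiffAt (hU.mem_nhds hx)).of_le (by simp))
      ((hY₀.contMDiffAt (hU.mem_nhds hx)).of_le (by simp)) hu.symm hw.symm]
    exact mfderiv_mk_mulInvariantVectorField_eq_zero hK hτ g (h X Y)

end Projectable

end Quotient

end Homogeneous

/-! ### The three equivalences -/

theorem mainTheorem4
    {E : Type*} [NormedAddCommGroup E] [NormedSpace ℝ E] [CompleteSpace E]
    {F : Type*} [NormedAddCommGroup F] [NormedSpace ℝ F] [CompleteSpace F]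
    {E₀ : Type*} [NormedAddCommGroup E₀] [NormedSpace ℝ E₀] [CompleteSpace E₀]
    {G : Type*} [TopologicalSpace G] [ChartedSpace E G] [Group G] [LieGroup 𝓘(ℝ, E) ∞ G]
    (K : Subgroup G) [ChartedSpace F K] [LieGroup 𝓘(ℝ, F) ∞ K]
    (hK : IsEmbeddedBanachSubgroup E F K)
    [ChartedSpace E₀ (G ⧸ K)] [IsManifold 𝓘(ℝ, E₀) ∞ (G ⧸ K)]
    (hτ : IsBanachFibration E E₀ (QuotientGroup.mk : G → G ⧸ K))
    (N : NOperator E G) (hinv : N.IsLeftInvariant)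
    (hproj : N.IsProjectable E₀ (QuotientGroup.mk : G → G ⧸ K)) :
    ((∃ N₀ : NOperator E₀ (G ⧸ K),
        NOperator.ProjectsOnto (QuotientGroup.mk : G → G ⧸ K) N N₀ ∧ N₀.IsComplexStructure) ↔
      ((∀ X : GroupLieAlgebra 𝓘(ℝ, E) G,
          N.atOne (N.atOne X) + X ∈ subgroupLieAlgebra E F K) ∧
        (∀ X Y : GroupLieAlgebra 𝓘(ℝ, E) G,
          lieTorsion N.atOne X Y ∈ subgroupLieAlgebra E F K))) ∧
    (((∀ X : GroupLieAlgebra 𝓘(ℝ, E) G,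
          N.atOne (N.atOne X) + X ∈ subgroupLieAlgebra E F K) ∧
        (∀ X Y : GroupLieAlgebra 𝓘(ℝ, E) G,
          lieTorsion N.atOne X Y ∈ subgroupLieAlgebra E F K)) ↔
      IsComplexLieSubalgebra (zPlus N.atOne (subgroupLieAlgebra E F K))) ∧
    (((∀ X : GroupLieAlgebra 𝓘(ℝ, E) G,
          N.atOne (N.atOne X) + X ∈ subgroupLieAlgebra E F K) ∧
        (∀ X Y : GroupLieAlgebra 𝓘(ℝ, E) G,
          lieTorsion N.atOne X Y ∈ subgroupLieAlgebra E F K)) ↔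
      IsComplexLieSubalgebra (zMinus N.atOne (subgroupLieAlgebra E F K))) := by 
  obtain ⟨N', hp⟩ := hproj
  -- The hypotheses of the algebraic criterion are insensitive to the sign of `N_e`, so one argument
  -- serves both `𝒵₊` and `𝒵₋`.
  have hz : ∀ N₁ : GroupLieAlgebra 𝓘(ℝ, E) G →ₗ[ℝ] GroupLieAlgebra 𝓘(ℝ, E) G,
      N₁ = N.atOne ∨ N₁ = -N.atOne →
      (((∀ X, N₁ (N₁ X) + X ∈ subgroupLieAlgebra E F K) ∧
        ∀ X Y, lieTorsion N₁ X Y ∈ subgroupLieAlgebra E F K) ↔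
      IsComplexLieSubalgebra (zPlus N₁ (subgroupLieAlgebra E F K))) := by
    intro N₁ hN₁
    refine isComplexLieSubalgebra_zPlus_iff N₁ _ ?_
      (fun k hk l hl => lie_mem_subgroupLieAlgebra hK hτ hk hl) ?_
    · rcases hN₁ with rfl | rfl
      · exact fun k hk => hp.atOne_mem hK hτ hk
      · exact fun k hk => Submodule.neg_mem _ (hp.atOne_mem hK hτ hk)
    · rcases hN₁ with rfl | rfl
      · exact fun k hk X => hp.lie_atOne_sub_mem hK hτ hinv hk X
      · intro k hk X
        convert Submodule.neg_mem _ (hp.lie_atOne_sub_mem hK hτ hinv hk X) using 1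
        simp only [LinearMap.neg_apply, lie_neg]
        abel
  refine ⟨⟨?_, ?_⟩, hz _ (Or.inl rfl), ?_⟩
  · rintro ⟨N₀, hp₀, hac, hnij⟩
    exact ⟨(hp₀.isAlmostComplex_iff hK hτ hinv).1 hac, (hp₀.isNijenhuis_iff hK hτ hinv).1 hnij⟩
  · rintro ⟨hsq, htor⟩
    exact ⟨N', hp, (hp.isAlmostComplex_iff hK hτ hinv).2 hsq,
      (hp.isNijenhuis_iff hK hτ hinv).2 htor⟩
  · rw [← zPlus_neg, ← hz _ (Or.inr rfl)]
    simp only [lieTorsion_neg, LinearMap.neg_apply, map_neg, neg_neg]
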